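/- Let $\widetilde M(\mu)$ be a complex space form of real dimension $2m$, i.e. a Kähler manifold, with metric $g$, parallel complex structure $J$ and Levi-Civita connection $\widetilde\nabla$, of constant holomorphic sectional curvature $\mu\in\mathbb R$. Let $M$ be an $n$-dimensional ($n>1$) immersed submanifold of $\widetilde M(\mu)$ with the induced metric. For tangent fields $X,Y$ and normal fields $\xi$ on $M$ let $\sigma(X,Y)$ be the normal component of $\widetilde\nabla_XY$ (the second fundamental form), let $-A_\xi X$ and $D_X\xi$ be the tangential and the normal component of $\widetilde\nabla_X\xi$, let $f\xi$ be the normal component of $J\xi$, let $H=\frac1n\operatorname{tr}\sigma$ be the mean curvature vector, and let $R^\perp(X,Y)\xi=D_XD_Y\xi-D_YD_X\xi-D_{[X,Y]}\xi$. Assume that 1. $M$ is totally real: $J T_pM\subset T_pM^\perp$ for every $p\in M$; 2. $M$ has commutative second fundamental forms: $A_\xi A_\eta=A_\eta A_\xi$ for all normal vector fields $\xi,\eta$; 3. the $f$-structure in the normal bundle is parallel: $D_X(f\xi)=f(D_X\xi)$ for all tangent fields $X$ and normal fields $\xi$ (the case $f=0$ is allowed); 4. the mean curvature vector is semiparallel: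 $R^\perp(X,Y)H=0$ for all tangent fields $X,Y$. Then $M$ is totally geodesic, i.e. $\sigma=0$, or $\mu=0$. -/

import Mathlib

open Bundle Module VectorField
open scoped Manifold ContDiff Topology RealInnerProductSpace

noncomputable section

/-! ### Kähler manifolds and complex space forms -/

section Ambient

variable {E : Type*} [NormedAddCommGroup E] [NormedSpace ℝ E] [FiniteDimensional ℝ E]
  {H : Type*} [TopologicalSpace H] {I : ModelWithCorners ℝ E H}
  {N : Type*} [TopologicalSpace N] [ChartedSpace H N] [IsManifold I ∞ N]

/-- `X` is a smooth vector field on `N`. -/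
def IsSmoothField (X : Π x : N, TangentSpace I x) : Prop :=
  ContMDiff I I.tangent ∞ (fun x ↦ (⟨x, X x⟩ : TangentBundle I N))

/-- `cov` is the Levi-Civita connection of the Riemannian manifold `N`: the smooth affine
connection which is torsion free and metric. Recall that `cov Y x v` is `∇_v Y` at `x`. -/
structure IsLeviCivita [RiemannianBundle (fun x : N ↦ TangentSpace I x)]
    [IsContMDiffRiemannianBundle I ∞ E (fun x : N ↦ TangentSpace I x)]
    (cov : CovariantDerivative I E (fun x : N ↦ TangentSpace I x)) : Prop where
  smooth : CovariantDerivative.ContMDiffCovariantDerivative cov ∞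
  torsion_free : cov.torsion = 0
  metric : ∀ (Y Z : Π x : N, TangentSpace I x) (x : N),
    MDifferentiableAt I I.tangent (fun y ↦ (⟨y, Y y⟩ : TangentBundle I N)) x →
    MDifferentiableAt I I.tangent (fun y ↦ (⟨y, Z y⟩ : TangentBundle I N)) x →
    ∀ v : TangentSpace I x, mvfderiv I (fun y ↦ ⟪Y y, Z y⟫) x v
      = ⟪cov Y x v, Z x⟫ + ⟪Y x, cov Z x v⟫

/-- The curvature of an affine connection on vector fields:
`R(X, Y) Z = ∇_X ∇_Y Z - ∇_Y ∇_X Z - ∇_{[X, Y]} Z`. -/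
def affineCurvature (cov : CovariantDerivative I E (fun x : N ↦ TangentSpace I x))
    (X Y Z : Π x : N, TangentSpace I x) (x : N) : TangentSpace I x :=
  cov (fun y ↦ cov Z y (Y y)) x (X x) - cov (fun y ↦ cov Z y (X y)) x (Y x)
    - cov Z x (mlieBracket I X Y x)

/-- `J` is a Kähler structure on the Riemannian manifold `N` with Levi-Civita connection `cov`: a
smooth field of endomorphisms of the tangent spaces with `J² = -1`, orthogonal for the metric, and
parallel, `∇_v (J Y) = J ∇_v Y`. -/
structure IsKaehlerStructure [RiemannianBundle (fun x : N ↦ TangentSpace I x)]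
    (cov : CovariantDerivative I E (fun x : N ↦ TangentSpace I x))
    (J : Π x : N, TangentSpace I x →L[ℝ] TangentSpace I x) : Prop where
  smooth : ContMDiff I (I.prod 𝓘(ℝ, E →L[ℝ] E)) ∞
    (fun x ↦ (⟨x, J x⟩ : TotalSpace (E →L[ℝ] E)
      (fun x : N ↦ TangentSpace I x →L[ℝ] TangentSpace I x)))
  sq : ∀ (x : N) (v : TangentSpace I x), J x (J x v) = -v
  orthogonal : ∀ (x : N) (v w : TangentSpace I x), ⟪J x v, J x w⟫ = ⟪v, w⟫
  parallel : ∀ Y : Π x : N, TangentSpace I x, IsSmoothField Y →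
    ∀ (x : N) (v : TangentSpace I x), cov (fun y ↦ J y (Y y)) x v = J x (cov Y x v)

/-- `N` has constant holomorphic sectional curvature `μ`:
`g(R(X, JX) JX, X) = μ g(X, X)²` for all `X`. -/
def HasConstantHolomorphicCurvature [RiemannianBundle (fun x : N ↦ TangentSpace I x)]
    (cov : CovariantDerivative I E (fun x : N ↦ TangentSpace I x))
    (J : Π x : N, TangentSpace I x →L[ℝ] TangentSpace I x) (μ : ℝ) : Prop :=
  ∀ X : Π x : N, TangentSpace I x, IsSmoothField X → ∀ x : N,
    ⟪affineCurvature cov X (fun y ↦ J y (X y)) (fun y ↦ J y (X y)) x, X x⟫ = μ * ⟪X x, X x⟫ ^ 2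

/-- `N`, with Levi-Civita connection `cov` and complex structure `J`, is a complex space form of
constant holomorphic sectional curvature `μ`. -/
structure IsComplexSpaceForm [RiemannianBundle (fun x : N ↦ TangentSpace I x)]
    [IsContMDiffRiemannianBundle I ∞ E (fun x : N ↦ TangentSpace I x)]
    (cov : CovariantDerivative I E (fun x : N ↦ TangentSpace I x))
    (J : Π x : N, TangentSpace I x →L[ℝ] TangentSpace I x) (μ : ℝ) : Prop where
  leviCivita : IsLeviCivita cov
  kaehler : IsKaehlerStructure cov J
  holomorphicCurvature : HasConstantHolomorphicCurvature cov J μ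

end Ambient

/-! ### Immersed submanifolds -/

section Submanifold

variable {E : Type*} [NormedAddCommGroup E] [NormedSpace ℝ E] [FiniteDimensional ℝ E]
  {H : Type*} [TopologicalSpace H] {I : ModelWithCorners ℝ E H}
  {M : Type*} [TopologicalSpace M] [ChartedSpace H M] [IsManifold I ∞ M]
  {E' : Type*} [NormedAddCommGroup E'] [NormedSpace ℝ E'] [FiniteDimensional ℝ E']
  {H' : Type*} [TopologicalSpace H'] {I' : ModelWithCorners ℝ E' H'}
  {N : Type*} [TopologicalSpace N] [ChartedSpace H' N] [IsManifold I' ∞ N]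

instance finiteDimensional_tangentSpace (x : M) : FiniteDimensional ℝ (TangentSpace I x) :=
  inferInstanceAs (FiniteDimensional ℝ E)

variable (I I') in
/-- `ξ` is a smooth vector field along `φ`, i.e. a smooth section of `φ^* TN`. -/
def IsSmoothAlong (φ : M → N) (ξ : Π p : M, TangentSpace I' (φ p)) : Prop :=
  ContMDiff I I'.tangent ∞ (fun p ↦ (⟨φ p, ξ p⟩ : TangentBundle I' N))

variable (I) in
/-- The covariant derivative `∇_v ξ` of a field `ξ` along `φ`, for `v ∈ T_p M`.
Read the tangent bundle of `N` in the trivialization around `φ p`, so that `ξ = ∑ ξⁱ (Eᵢ ∘ φ)` with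
`Eᵢ` the frame given by the trivialization; then
`∇_v ξ = ∑ (dξⁱ v) Eᵢ + ∑ ξⁱ(p) ∇_{dφ v} Eᵢ`.
The second sum is the derivative of the field `∑ ξⁱ(p) Eᵢ` with constant components, which is
`FiberBundle.extend E' (ξ p)`. -/
def covAlong (cov : CovariantDerivative I' E' (fun x : N ↦ TangentSpace I' x)) (φ : M → N)
    (ξ : Π p : M, TangentSpace I' (φ p)) (p : M) (v : TangentSpace I p) :
    TangentSpace I' (φ p) :=
  let e := trivializationAt E' (fun x : N ↦ TangentSpace I' x) (φ p)
  e.symm (φ p) (mvfderiv I (fun q ↦ (e ⟨φ q, ξ q⟩).2) p v)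
    + cov (FiberBundle.extend E' (ξ p)) (φ p) (mfderiv I I' φ p v)

variable [RiemannianBundle (fun x : M ↦ TangentSpace I x)]
  [RiemannianBundle (fun x : N ↦ TangentSpace I' x)]

variable (I I') in
/-- `φ : M → N` makes `M` an immersed submanifold of `N` with the induced metric. (An isometric
differential is injective.) -/
structure IsIsometricImmersion (φ : M → N) : Prop where
  smooth : ContMDiff I I' ∞ φ
  isometric : ∀ (p : M) (v w : TangentSpace I p),
    ⟪mfderiv I I' φ p v, mfderiv I I' φ p w⟫ = ⟪v, w⟫

variable (I I') in
/-- The tangential component, as a vector of `T_p M`, of a vector of `T_{φ p} N`: for an isometric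
immersion the adjoint of `dφ` is the orthogonal projection onto `T_p M`. -/
def tangentialPart (φ : M → N) (p : M) : TangentSpace I' (φ p) →ₗ[ℝ] TangentSpace I p :=
  LinearMap.adjoint (mfderiv I I' φ p : TangentSpace I p →ₗ[ℝ] TangentSpace I' (φ p))

variable (I I') in
/-- The normal component of a vector of `T_{φ p} N`. -/
def normalPart (φ : M → N) (p : M) (w : TangentSpace I' (φ p)) : TangentSpace I' (φ p) :=
  w - mfderiv I I' φ p (tangentialPart I I' φ p w)

variable (I I') in
/-- `ξ` is a smooth normal vector field. -/
structure IsNormalField (φ : M → N) (ξ : Π p : M, TangentSpace I' (φ p)) : Prop where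
  smooth : IsSmoothAlong I I' φ ξ
  normal : ∀ (p : M) (v : TangentSpace I p), ⟪ξ p, mfderiv I I' φ p v⟫ = 0

variable (cov : CovariantDerivative I' E' (fun x : N ↦ TangentSpace I' x)) (φ : M → N)

/-- The second fundamental form `σ(v, w)`, by the Gauss formula the normal component of `∇_v W`,
where `W` is an extension of `w` to a vector field on `M` that is smooth around `p`. -/
def secondFundamentalForm (p : M) (v w : TangentSpace I p) : TangentSpace I' (φ p) :=
  normalPart I I' φ p
    (covAlong I cov φ (fun q ↦ mfderiv I I' φ q (FiberBundle.extend E w q)) p v)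

variable (I) in
/-- The mean curvature vector `H = (1 / n) tr σ`, where `n = dim M`. -/
def meanCurvature (p : M) : TangentSpace I' (φ p) :=
  (finrank ℝ E : ℝ)⁻¹ • ∑ i, secondFundamentalForm cov φ p
    (stdOrthonormalBasis ℝ (TangentSpace I p) i) (stdOrthonormalBasis ℝ (TangentSpace I p) i)

/-- The shape operator `A_ξ` of a normal field `ξ`, by the Weingarten formula: `-A_ξ v` is the
tangential component of `∇_v ξ`. -/
def shapeOperator (ξ : Π p : M, TangentSpace I' (φ p)) (p : M) (v : TangentSpace I p) :
    TangentSpace I p :=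
  -tangentialPart I I' φ p (covAlong I cov φ ξ p v)

/-- The normal connection: `D_v ξ` is the normal component of `∇_v ξ`. -/
def normalConnection (ξ : Π p : M, TangentSpace I' (φ p)) (p : M) (v : TangentSpace I p) :
    TangentSpace I' (φ p) :=
  normalPart I I' φ p (covAlong I cov φ ξ p v)

/-- The curvature of the normal connection:
`R^⊥(X, Y) ξ = D_X D_Y ξ - D_Y D_X ξ - D_{[X, Y]} ξ`. -/
def normalCurvature (X Y : Π p : M, TangentSpace I p) (ξ : Π p : M, TangentSpace I' (φ p))
    (p : M) : TangentSpace I' (φ p) :=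
  normalConnection cov φ (fun q ↦ normalConnection cov φ ξ q (Y q)) p (X p)
    - normalConnection cov φ (fun q ↦ normalConnection cov φ ξ q (X q)) p (Y p)
    - normalConnection cov φ ξ p (mlieBracket I X Y p)

variable (I) in
/-- `M` is totally real: `J T_p M` is orthogonal to `T_p M`. -/
def IsTotallyReal (J : Π x : N, TangentSpace I' x →L[ℝ] TangentSpace I' x) : Prop :=
  ∀ (p : M) (v w : TangentSpace I p),
    ⟪J (φ p) (mfderiv I I' φ p v), mfderiv I I' φ p w⟫ = 0

variable (I) in
/-- `M` has commutative second fundamental forms: `A_ξ A_η = A_η A_ξ` for all normal fields. -/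
def HasCommutativeSecondFundamentalForms : Prop :=
  ∀ ξ η : Π p : M, TangentSpace I' (φ p), IsNormalField I I' φ ξ → IsNormalField I I' φ η →
    ∀ (p : M) (v : TangentSpace I p),
      shapeOperator cov φ ξ p (shapeOperator cov φ η p v)
        = shapeOperator cov φ η p (shapeOperator cov φ ξ p v)

variable (I) in
/-- The endomorphism `f` of the normal bundle: `f ξ` is the normal component of `J ξ`. -/
def normalF (J : Π x : N, TangentSpace I' x →L[ℝ] TangentSpace I' x) (p : M)
    (ξ : TangentSpace I' (φ p)) : TangentSpace I' (φ p) :=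
  normalPart I I' φ p (J (φ p) ξ)

variable (I) in
/-- The `f`-structure in the normal bundle is parallel: `D_v (f ξ) = f (D_v ξ)` for all normal
fields. -/
def HasParallelNormalFStructure (J : Π x : N, TangentSpace I' x →L[ℝ] TangentSpace I' x) : Prop :=
  ∀ ξ : Π p : M, TangentSpace I' (φ p), IsNormalField I I' φ ξ →
    ∀ (p : M) (v : TangentSpace I p),
      normalConnection cov φ (fun q ↦ normalF I φ J q (ξ q)) p v
        = normalF I φ J p (normalConnection cov φ ξ p v)

variable (I) in
/-- The mean curvature vector is semiparallel: `R^⊥(X, Y) H = 0` for all vector fields on `M`. -/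
def HasSemiparallelMeanCurvature : Prop :=
  ∀ X Y : Π p : M, TangentSpace I p, IsSmoothField X → IsSmoothField Y →
    ∀ p : M, normalCurvature cov φ X Y (meanCurvature I cov φ) p = 0

variable (I) in
/-- `M` is totally geodesic: `σ = 0`. -/
def IsTotallyGeodesic : Prop :=
  ∀ (p : M) (v w : TangentSpace I p), secondFundamentalForm cov φ p v w = 0

end Submanifold

end

/-! Suppose μ ≠ 0; all the geometry happens at one point p. Since M is totally real, Jw is normal
for every tangent w. Comparing the normal parts in D(fξ) = f(Dξ) for a normal field ξ with ξ(p) = Jw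
gives σ(v, w) = J A_{Jw} v (`secondFundamentalForm_eq_of_parallel`). So σ takes values in J TM and
is encoded by the operators A_w := A_{Jw} on T_pM, which are self-adjoint, commute, and satisfy A_v
w = A_w v because σ is symmetric (`exists_shapeOperator`). In particular H = Jh with h tangent.

As the shape operators commute, their commutator drops out of the Ricci equation and R^⊥ is the
normal part of the ambient curvature R (`inner_normalCurvature_of_commute`). Since n > 1 there is a
tangent x ≠ 0 orthogonal to h. Semiparallelity gives 0 = ⟨R(x, h) Jh, Jx⟩ = ⟨R(x, h) h, x⟩, and the
last term is (μ/4)|x|²|h|², because x and h are orthogonal and x ⟂ Jh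
(`inner_curvatureTensor_of_orthogonal`). Hence h = 0 (`meanCurvature_eq_zero`).

Finally, the symmetries of A give |A_u b_i|² = ⟨A_{b_i} b_i, A_u u⟩ for an orthonormal basis b_i.
The sum over i is a multiple of ⟨h, A_u u⟩ = 0, so A = 0 and σ = 0 (`eq_zero_of_sum_eq_zero`).

Most of the length is the calculus behind the Ricci equation. A field along an immersion need not be
the restriction of an ambient field, so metricity, vanishing torsion, parallelism of J and the
curvature are all transferred to the pulled back connection `covAlong`. The tool is
`IsSmoothAlong.induction`: near a point every smooth field along φ is a combination, with smooth
coefficients, of restrictions W ∘ φ. -/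

set_option linter.unusedSectionVars false

/-! ### Smooth vector fields along a map -/

section Along

variable {E : Type*} [NormedAddCommGroup E] [NormedSpace ℝ E] [FiniteDimensional ℝ E]
  {H : Type*} [TopologicalSpace H] {I : ModelWithCorners ℝ E H}
  {M : Type*} [TopologicalSpace M] [ChartedSpace H M] [IsManifold I ∞ M]
  {E' : Type*} [NormedAddCommGroup E'] [NormedSpace ℝ E'] [FiniteDimensional ℝ E']
  {H' : Type*} [TopologicalSpace H'] {I' : ModelWithCorners ℝ E' H'}
  {N : Type*} [TopologicalSpace N] [ChartedSpace H' N] [IsManifold I' ∞ N]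
  {φ : M → N} {ξ η : Π p : M, TangentSpace I' (φ p)} {p : M}

section Coordinates

variable (I') in
/-- The coordinates of a tangent vector at `x` in the trivialization around `x₀`. -/
noncomputable def tangentCoord (x₀ x : N) (v : TangentSpace I' x) : E' :=
  (trivializationAt E' (TangentSpace I' : N → Type _) x₀ ⟨x, v⟩).2

lemma eventually_mem_baseSet (x₀ : N) :
    ∀ᶠ x in 𝓝 x₀, x ∈ (trivializationAt E' (TangentSpace I' : N → Type _) x₀).baseSet :=
  (trivializationAt E' (TangentSpace I' : N → Type _) x₀).open_baseSet.mem_nhds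
    (FiberBundle.mem_baseSet_trivializationAt' x₀)

lemma eventually_comp_mem_baseSet (hφ : ContMDiff I I' ∞ φ) (p : M) :
    ∀ᶠ q in 𝓝 p, φ q ∈ (trivializationAt E' (TangentSpace I' : N → Type _) (φ p)).baseSet :=
  hφ.continuous.continuousAt.eventually (eventually_mem_baseSet (φ p))

lemma tangentCoord_add {x₀ x : N}
    (hx : x ∈ (trivializationAt E' (TangentSpace I' : N → Type _) x₀).baseSet)
    (v w : TangentSpace I' x) :
    tangentCoord I' x₀ x (v + w) = tangentCoord I' x₀ x v + tangentCoord I' x₀ x w :=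
  ((trivializationAt E' (TangentSpace I' : N → Type _) x₀).linear ℝ hx).map_add v w

lemma tangentCoord_smul {x₀ x : N}
    (hx : x ∈ (trivializationAt E' (TangentSpace I' : N → Type _) x₀).baseSet)
    (c : ℝ) (v : TangentSpace I' x) :
    tangentCoord I' x₀ x (c • v) = c • tangentCoord I' x₀ x v :=
  ((trivializationAt E' (TangentSpace I' : N → Type _) x₀).linear ℝ hx).map_smul c v

lemma tangentCoord_symm {x₀ x : N}
    (hx : x ∈ (trivializationAt E' (TangentSpace I' : N → Type _) x₀).baseSet) (w : E') :
    tangentCoord I' x₀ x ((trivializationAt E' (TangentSpace I' : N → Type _) x₀).symm x w)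
      = w := by
  rw [tangentCoord, Trivialization.apply_mk_symm _ hx]

lemma symm_tangentCoord {x₀ x : N}
    (hx : x ∈ (trivializationAt E' (TangentSpace I' : N → Type _) x₀).baseSet)
    (v : TangentSpace I' x) :
    (trivializationAt E' (TangentSpace I' : N → Type _) x₀).symm x (tangentCoord I' x₀ x v) = v :=
  Trivialization.symm_apply_apply_mk _ hx v

lemma symm_add {x₀ x : N}
    (hx : x ∈ (trivializationAt E' (TangentSpace I' : N → Type _) x₀).baseSet) (v w : E') :
    (trivializationAt E' (TangentSpace I' : N → Type _) x₀).symm x (v + w)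
      = (trivializationAt E' (TangentSpace I' : N → Type _) x₀).symm x v
        + (trivializationAt E' (TangentSpace I' : N → Type _) x₀).symm x w := by
  simpa only [Trivialization.coe_symmₗ _ hx] using
    ((trivializationAt E' (TangentSpace I' : N → Type _) x₀).symmₗ ℝ x).map_add v w

lemma symm_smul {x₀ x : N}
    (hx : x ∈ (trivializationAt E' (TangentSpace I' : N → Type _) x₀).baseSet)
    (c : ℝ) (v : E') :
    (trivializationAt E' (TangentSpace I' : N → Type _) x₀).symm x (c • v)
      = c • (trivializationAt E' (TangentSpace I' : N → Type _) x₀).symm x v := by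
  simpa only [Trivialization.coe_symmₗ _ hx] using
    ((trivializationAt E' (TangentSpace I' : N → Type _) x₀).symmₗ ℝ x).map_smul c v

end Coordinates

section Smoothness

/-- Once φ is smooth, only the fibre coordinate matters; it is a function with values in a fixed
vector space, additive and homogeneous in the field near the point. -/
lemma isSmoothAlong_iff (hφ : ContMDiff I I' ∞ φ) :
    IsSmoothAlong I I' φ ξ ↔
      ∀ p, ContMDiffAt I 𝓘(ℝ, E') ∞ (fun q ↦ tangentCoord I' (φ p) (φ q) (ξ q)) p := by
  refine forall_congr' fun p ↦ ?_
  rw [contMDiffAt_totalSpace]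
  exact ⟨fun h ↦ h.2, fun h ↦ ⟨hφ p, h⟩⟩

lemma IsSmoothAlong.base (hξ : IsSmoothAlong I I' φ ξ) : ContMDiff I I' ∞ φ :=
  fun p ↦ (contMDiffAt_totalSpace.1 (hξ p)).1

lemma IsSmoothAlong.coord (hξ : IsSmoothAlong I I' φ ξ) (p : M) :
    ContMDiffAt I 𝓘(ℝ, E') ∞ (fun q ↦ tangentCoord I' (φ p) (φ q) (ξ q)) p :=
  (isSmoothAlong_iff hξ.base).1 hξ p

lemma IsSmoothAlong.mdifferentiableAt_coord (hξ : IsSmoothAlong I I' φ ξ) (p : M) :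
    MDifferentiableAt I 𝓘(ℝ, E') (fun q ↦ tangentCoord I' (φ p) (φ q) (ξ q)) p :=
  (hξ.coord p).mdifferentiableAt (by simp)

lemma IsSmoothAlong.add (hξ : IsSmoothAlong I I' φ ξ) (hη : IsSmoothAlong I I' φ η) :
    IsSmoothAlong I I' φ (fun q ↦ ξ q + η q) := by
  rw [isSmoothAlong_iff hξ.base]
  intro p
  refine ((hξ.coord p).add (hη.coord p)).congr_of_eventuallyEq ?_
  filter_upwards [eventually_comp_mem_baseSet hξ.base p] with q hq
  exact tangentCoord_add hq _ _

lemma IsSmoothAlong.smul {f : M → ℝ} (hf : ContMDiff I 𝓘(ℝ, ℝ) ∞ f)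
    (hξ : IsSmoothAlong I I' φ ξ) : IsSmoothAlong I I' φ (fun q ↦ f q • ξ q) := by
  rw [isSmoothAlong_iff hξ.base]
  intro p
  refine ((hf p).smul (hξ.coord p)).congr_of_eventuallyEq ?_
  filter_upwards [eventually_comp_mem_baseSet hξ.base p] with q hq
  exact tangentCoord_smul hq _ _

lemma IsSmoothAlong.const_smul (c : ℝ) (hξ : IsSmoothAlong I I' φ ξ) :
    IsSmoothAlong I I' φ (fun q ↦ c • ξ q) :=
  IsSmoothAlong.smul contMDiff_const hξ

lemma IsSmoothAlong.neg (hξ : IsSmoothAlong I I' φ ξ) :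
    IsSmoothAlong I I' φ (fun q ↦ -ξ q) := by
  simpa using hξ.const_smul (-1)

lemma IsSmoothAlong.sub (hξ : IsSmoothAlong I I' φ ξ) (hη : IsSmoothAlong I I' φ η) :
    IsSmoothAlong I I' φ (fun q ↦ ξ q - η q) := by
  simpa [sub_eq_add_neg] using hξ.add hη.neg

lemma IsSmoothField.isSmoothAlong {W : Π x : N, TangentSpace I' x} (hW : IsSmoothField W)
    (hφ : ContMDiff I I' ∞ φ) : IsSmoothAlong I I' φ (fun q ↦ W (φ q)) :=
  ContMDiff.comp (g := fun x ↦ (⟨x, W x⟩ : TangentBundle I' N)) hW hφ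

lemma isSmoothField_zero : IsSmoothField (fun x : N ↦ (0 : TangentSpace I' x)) :=
  contMDiff_zeroSection ℝ (TangentSpace I' : N → Type _)

lemma IsSmoothAlong.sum {ι : Type*} (s : Finset ι) {ζ : ι → Π p : M, TangentSpace I' (φ p)}
    (hφ : ContMDiff I I' ∞ φ) (hζ : ∀ i ∈ s, IsSmoothAlong I I' φ (ζ i)) :
    IsSmoothAlong I I' φ (fun q ↦ ∑ i ∈ s, ζ i q) := by
  classical
  induction s using Finset.induction_on with
  | empty => simpa using isSmoothField_zero.isSmoothAlong hφ
  | insert a s ha ih =>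
    simp only [Finset.sum_insert ha]
    exact (hζ a (by simp)).add (ih fun i hi ↦ hζ i (by simp [hi]))

lemma isSmoothAlong_of_eventuallyEq
    (h : ∀ p, ∃ ζ, IsSmoothAlong I I' φ ζ ∧ ∀ᶠ q in 𝓝 p, ξ q = ζ q) : IsSmoothAlong I I' φ ξ := by
  intro p
  obtain ⟨ζ, hζ, h⟩ := h p
  refine (hζ p).congr_of_eventuallyEq ?_
  filter_upwards [h] with q hq
  rw [hq]

lemma IsSmoothAlong.mfderiv {X : Π p : M, TangentSpace I p} (hφ : ContMDiff I I' ∞ φ)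
    (hX : IsSmoothField X) : IsSmoothAlong I I' φ (fun q ↦ mfderiv I I' φ q (X q)) :=
  (hφ.contMDiff_tangentMap (m := ∞) (by simp)).comp hX

lemma IsSmoothField.isSmoothAlong_id {X : Π p : M, TangentSpace I p} (hX : IsSmoothField X) :
    IsSmoothAlong I I id X := hX

lemma IsSmoothField.mdifferentiableAt {X : Π p : M, TangentSpace I p} (hX : IsSmoothField X)
    (p : M) : MDifferentiableAt I I.tangent (fun y ↦ (⟨y, X y⟩ : TangentBundle I M)) p :=
  (hX p).mdifferentiableAt (by simp)

lemma contMDiff_mvfderiv {f : M → ℝ} {X : Π p : M, TangentSpace I p}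
    (hf : ContMDiff I 𝓘(ℝ, ℝ) ∞ f) (hX : IsSmoothField X) :
    ContMDiff I 𝓘(ℝ, ℝ) ∞ (fun q ↦ mvfderiv I f q (X q)) :=
  (contMDiff_snd_tangentBundle_modelSpace ℝ 𝓘(ℝ, ℝ)).comp (IsSmoothAlong.mfderiv hf hX)

end Smoothness

/-! ### Localization: cutoffs, local frames and tensoriality -/

section Cutoff

variable [T2Space M]

lemma exists_smooth_bump {U : Set M} (hU : U ∈ 𝓝 p) :
    ∃ χ : M → ℝ, ContMDiff I 𝓘(ℝ, ℝ) ∞ χ ∧ (∀ᶠ q in 𝓝 p, χ q = 1) ∧ tsupport χ ⊆ U := by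
  obtain ⟨f, hf, -⟩ := (SmoothBumpFunction.nhds_basis_support (I := I) hU).mem_iff.1
    (Filter.univ_mem)
  exact ⟨f, f.contMDiff, f.eventuallyEq_one, hf⟩

/-- The product of f with a bump function supported where f is smooth: off the closed support it
vanishes, on it both factors are smooth. -/
lemma exists_contMDiff_eventuallyEq {F : Type*} [NormedAddCommGroup F] [NormedSpace ℝ F]
    {f : M → F} (hf : ∀ᶠ q in 𝓝 p, ContMDiffAt I 𝓘(ℝ, F) ∞ f q) :
    ∃ g : M → F, ContMDiff I 𝓘(ℝ, F) ∞ g ∧ ∀ᶠ q in 𝓝 p, g q = f q := by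
  obtain ⟨χ, hχ, hχ1, hsupp⟩ := exists_smooth_bump (I := I) hf
  refine ⟨fun q ↦ χ q • f q, contMDiff_of_tsupport fun q hq ↦ ?_, ?_⟩
  · exact (hχ q).smul (hsupp (tsupport_smul_subset_left χ f hq))
  · filter_upwards [hχ1] with q hq
    simp [hq]

lemma exists_isSmoothAlong_eventuallyEq (hφ : ContMDiff I I' ∞ φ)
    (hξ : ∀ᶠ q in 𝓝 p,
      ContMDiffAt I I'.tangent ∞ (fun q ↦ (⟨φ q, ξ q⟩ : TangentBundle I' N)) q) :
    ∃ ζ, IsSmoothAlong I I' φ ζ ∧ ∀ᶠ q in 𝓝 p, ζ q = ξ q := by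
  obtain ⟨χ, hχ, hχ1, hsupp⟩ := exists_smooth_bump (I := I) hξ
  refine ⟨fun q ↦ χ q • ξ q, ?_, by filter_upwards [hχ1] with q hq; simp [hq]⟩
  rw [isSmoothAlong_iff hφ]
  intro q
  by_cases hq : q ∈ tsupport χ
  · have := (contMDiffAt_totalSpace.1 (hsupp hq)).2
    refine ((hχ q).smul this).congr_of_eventuallyEq ?_
    filter_upwards [eventually_comp_mem_baseSet hφ q] with y hy
    exact tangentCoord_smul hy _ _
  · refine ((isSmoothField_zero.isSmoothAlong hφ).coord q).congr_of_eventuallyEq ?_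
    filter_upwards [(isClosed_tsupport χ).isOpen_compl.mem_nhds hq] with y hy
    have : χ y = 0 := image_eq_zero_of_notMem_tsupport hy
    simp [this]

variable (I) in
/-- Every tangent vector extends to a smooth vector field with constant coordinates around the
base point. -/
lemma exists_isSmoothField_extend (p : M) (v : TangentSpace I p) :
    ∃ X : Π q : M, TangentSpace I q, IsSmoothField X ∧
      ∀ᶠ q in 𝓝 p, X q = FiberBundle.extend E v q := by
  refine exists_isSmoothAlong_eventuallyEq (φ := (id : M → M)) contMDiff_id ?_
  obtain ⟨s, hs, h⟩ := FiberBundle.exists_contMDiffOn_extend (k := ∞) I E v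
  filter_upwards [eventually_mem_nhds_iff.2 hs] with q hq
  exact h.contMDiffAt hq

lemma exists_isSmoothField_eq (p : M) (v : TangentSpace I p) :
    ∃ X : Π q : M, TangentSpace I q, IsSmoothField X ∧ X p = v := by
  obtain ⟨X, hX, h⟩ := exists_isSmoothField_extend I p v
  exact ⟨X, hX, by simpa using h.self_of_nhds⟩

/-- There is a frame of smooth vector fields around `φ p`, in which the smooth fields along `φ` have
smooth components. -/
lemma exists_frame_along [T2Space N] (hφ : ContMDiff I I' ∞ φ) (p : M) :
    ∃ (W : Fin (finrank ℝ E') → Π x : N, TangentSpace I' x)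
      (c : Fin (finrank ℝ E') → TangentSpace I' (φ p) →ₗ[ℝ] ℝ),
      (∀ i, IsSmoothField (W i)) ∧ ∀ ξ, IsSmoothAlong I I' φ ξ →
        ∃ f : Fin (finrank ℝ E') → M → ℝ, (∀ i, ContMDiff I 𝓘(ℝ, ℝ) ∞ (f i)) ∧
          (∀ i, f i p = c i (ξ p)) ∧ ∀ᶠ q in 𝓝 p, ξ q = ∑ i, f i q • W i (φ q) := by
  set e := trivializationAt E' (TangentSpace I' : N → Type _) (φ p) with he
  have hmem : φ p ∈ e.baseSet := FiberBundle.mem_baseSet_trivializationAt' (φ p)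
  let b := finBasis ℝ E'
  have hW (i) := exists_isSmoothField_extend I' (φ p) (e.symm (φ p) (b i))
  choose W hW hWe using hW
  let c (i : Fin (finrank ℝ E')) : TangentSpace I' (φ p) →ₗ[ℝ] ℝ :=
    { toFun := fun u ↦ b.repr (tangentCoord I' (φ p) (φ p) u) i
      map_add' := fun u v ↦ by simp [tangentCoord_add hmem]
      map_smul' := fun r u ↦ by simp [tangentCoord_smul hmem] }
  refine ⟨W, c, hW, fun ξ hξ ↦ ?_⟩
  -- The cutoff needs smoothness at all points near p in the one trivialization around φ p, whereas
  -- `IsSmoothAlong.coord` speaks only about the centre of the trivialization.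
  have hcoord : ∀ᶠ q in 𝓝 p,
      ContMDiffAt I 𝓘(ℝ, E') ∞ (fun q ↦ tangentCoord I' (φ p) (φ q) (ξ q)) q := by
    filter_upwards [eventually_comp_mem_baseSet hφ p] with q hq
    exact ((e.contMDiffAt_iff (IB := I') (f := fun q ↦ (⟨φ q, ξ q⟩ : TangentBundle I' N))
      (x₀ := q) (n := ∞) (IM := I) (e.mem_source.2 hq)).1 (hξ q)).2
  have hf (i) : ∃ f : M → ℝ, ContMDiff I 𝓘(ℝ, ℝ) ∞ f ∧
      ∀ᶠ q in 𝓝 p, f q = b.repr (tangentCoord I' (φ p) (φ q) (ξ q)) i := by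
    refine exists_contMDiff_eventuallyEq ?_
    filter_upwards [hcoord] with q hq
    exact ((b.coord i).toContinuousLinearMap.contMDiff.contMDiffAt).comp q hq
  choose f hf hfe using hf
  refine ⟨f, hf, fun i ↦ (hfe i).self_of_nhds, ?_⟩
  filter_upwards [eventually_comp_mem_baseSet hφ p, Filter.eventually_all.2 hfe,
    hφ.continuous.continuousAt.eventually (Filter.eventually_all.2 hWe)] with q hq h1 h2
  have h3 (i) : W i (φ q) = e.symm (φ q) (b i) := by
    rw [h2 i, FiberBundle.extend]
    congr 1
    exact tangentCoord_symm hmem (b i)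
  simp only [h1, h3]
  conv_lhs => rw [← symm_tangentCoord hq (ξ q), ← b.sum_repr (tangentCoord I' (φ p) (φ q) (ξ q))]
  have := map_sum (e.symmₗ ℝ (φ q))
    (fun i ↦ b.repr (tangentCoord I' (φ p) (φ q) (ξ q)) i • b i) Finset.univ
  simpa only [map_smul, Trivialization.coe_symmₗ e hq] using this

/-- To prove a local and tensorial property of the fields along `φ` that are smooth, it is enough
to prove it for the restrictions `W ∘ φ` of vector fields. -/
theorem IsSmoothAlong.induction [T2Space N] (hφ : ContMDiff I I' ∞ φ) (p : M)
    {P : (Π q : M, TangentSpace I' (φ q)) → Prop}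
    (congr : ∀ ξ η, IsSmoothAlong I I' φ ξ → IsSmoothAlong I I' φ η →
      (∀ᶠ q in 𝓝 p, η q = ξ q) → P ξ → P η)
    (add : ∀ ξ η, IsSmoothAlong I I' φ ξ → IsSmoothAlong I I' φ η → P ξ → P η →
      P (fun q ↦ ξ q + η q))
    (smul : ∀ (f : M → ℝ) (ξ), ContMDiff I 𝓘(ℝ, ℝ) ∞ f → IsSmoothAlong I I' φ ξ → P ξ →
      P (fun q ↦ f q • ξ q))
    (comp : ∀ W : Π x : N, TangentSpace I' x, IsSmoothField W → P (fun q ↦ W (φ q)))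
    {ξ : Π q : M, TangentSpace I' (φ q)} (hξ : IsSmoothAlong I I' φ ξ) : P ξ := by
  classical
  obtain ⟨W, _, hW, hWξ⟩ := exists_frame_along hφ p
  obtain ⟨f, hf, -, h⟩ := hWξ ξ hξ
  have key (s : Finset (Fin (finrank ℝ E'))) : P (fun q ↦ ∑ i ∈ s, f i q • W i (φ q)) := by
    induction s using Finset.induction_on with
    | empty => simpa using comp _ isSmoothField_zero
    | insert a s ha ih =>
      simp only [Finset.sum_insert ha]
      exact add _ _ (.smul (hf a) ((hW a).isSmoothAlong hφ))
        (.sum s hφ fun i _ ↦ .smul (hf i) ((hW i).isSmoothAlong hφ))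
        (smul _ _ (hf a) ((hW a).isSmoothAlong hφ) (comp _ (hW a))) ih
  exact congr _ _ (.sum _ hφ fun i _ ↦ .smul (hf i) ((hW i).isSmoothAlong hφ)) hξ h (key _)

/-- A local operation on the smooth fields along `φ` that is linear over the smooth functions
factors through the evaluation at a point. -/
theorem exists_linearMap_of_tensorial [T2Space N] (hφ : ContMDiff I I' ∞ φ) (p : M)
    {A : Type*} [AddCommGroup A] [Module ℝ A] {Φ : (Π q : M, TangentSpace I' (φ q)) → A}
    (congr : ∀ ξ η, IsSmoothAlong I I' φ ξ → IsSmoothAlong I I' φ η →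
      (∀ᶠ q in 𝓝 p, η q = ξ q) → Φ η = Φ ξ)
    (add : ∀ ξ η, IsSmoothAlong I I' φ ξ → IsSmoothAlong I I' φ η →
      Φ (fun q ↦ ξ q + η q) = Φ ξ + Φ η)
    (smul : ∀ (f : M → ℝ) (ξ), ContMDiff I 𝓘(ℝ, ℝ) ∞ f → IsSmoothAlong I I' φ ξ →
      Φ (fun q ↦ f q • ξ q) = f p • Φ ξ) :
    ∃ L : TangentSpace I' (φ p) →ₗ[ℝ] A, ∀ ξ, IsSmoothAlong I I' φ ξ → Φ ξ = L (ξ p) := by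
  classical
  obtain ⟨W, c, hW, hWξ⟩ := exists_frame_along hφ p
  refine ⟨∑ i, (c i).smulRight (Φ fun q ↦ W i (φ q)), fun ξ hξ ↦ ?_⟩
  obtain ⟨f, hf, hfc, h⟩ := hWξ ξ hξ
  have key (s : Finset (Fin (finrank ℝ E'))) :
      Φ (fun q ↦ ∑ i ∈ s, f i q • W i (φ q)) = ∑ i ∈ s, f i p • Φ (fun q ↦ W i (φ q)) := by
    induction s using Finset.induction_on with
    | empty =>
      have h0 := smul (fun _ ↦ 0) _ contMDiff_const (isSmoothField_zero.isSmoothAlong hφ)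
      simpa using h0
    | insert a s ha ih =>
      simp only [Finset.sum_insert ha]
      rw [add _ _ (.smul (hf a) ((hW a).isSmoothAlong hφ))
        (.sum s hφ fun i _ ↦ .smul (hf i) ((hW i).isSmoothAlong hφ)),
        smul _ _ (hf a) ((hW a).isSmoothAlong hφ), ih]
  rw [congr _ _ (.sum _ hφ fun i _ ↦ .smul (hf i) ((hW i).isSmoothAlong hφ)) hξ h, key]
  simp [LinearMap.sum_apply, hfc]

end Cutoff

end Along

/-! ### The covariant derivative along a map -/

section CovAlong

variable {E : Type*} [NormedAddCommGroup E] [NormedSpace ℝ E] [FiniteDimensional ℝ E]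
  {H : Type*} [TopologicalSpace H] {I : ModelWithCorners ℝ E H}
  {M : Type*} [TopologicalSpace M] [ChartedSpace H M] [IsManifold I ∞ M]
  {E' : Type*} [NormedAddCommGroup E'] [NormedSpace ℝ E'] [FiniteDimensional ℝ E']
  {H' : Type*} [TopologicalSpace H'] {I' : ModelWithCorners ℝ E' H'}
  {N : Type*} [TopologicalSpace N] [ChartedSpace H' N] [IsManifold I' ∞ N]
  {φ : M → N} {ξ η : Π p : M, TangentSpace I' (φ p)} {p : M}

lemma mvfderiv_congr {F : Type*} [NormedAddCommGroup F] [NormedSpace ℝ F] {f g : M → F}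
    (h : f =ᶠ[𝓝 p] g) (v : TangentSpace I p) : mvfderiv I f p v = mvfderiv I g p v := by
  have h1 := h.mfderiv_eq (I := I) (I' := 𝓘(ℝ, F))
  have h2 : (mfderiv I 𝓘(ℝ, F) f p v : F) = mfderiv I 𝓘(ℝ, F) g p v := by rw [h1]; rfl
  exact h2

variable (cov : CovariantDerivative I' E' (fun x : N ↦ TangentSpace I' x))

/-- The difference between the covariant derivative and the derivative of the coordinates in the
trivialization around the point is tensorial. -/
lemma exists_connectionForm (x : N) (v : TangentSpace I' x) :
    ∃ Γ : TangentSpace I' x →ₗ[ℝ] TangentSpace I' x,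
      (∀ u, cov (FiberBundle.extend E' u) x v = Γ u) ∧
      ∀ W : Π y : N, TangentSpace I' y,
        MDifferentiableAt I' I'.tangent (fun y ↦ (⟨y, W y⟩ : TangentBundle I' N)) x →
        cov W x v = (trivializationAt E' (TangentSpace I' : N → Type _) x).symm x
          (mvfderiv I' (fun y ↦ tangentCoord I' x y (W y)) x v) + Γ (W x) := by
  set e := trivializationAt E' (TangentSpace I' : N → Type _) x with he
  have hx : x ∈ e.baseSet := FiberBundle.mem_baseSet_trivializationAt' x
  have hd {W : Π y : N, TangentSpace I' y}
      (hW : MDifferentiableAt I' I'.tangent (fun y ↦ (⟨y, W y⟩ : TangentBundle I' N)) x) :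
      MDifferentiableAt I' 𝓘(ℝ, E') (fun y ↦ tangentCoord I' x y (W y)) x :=
    ((mdifferentiableAt_totalSpace I' _).1 hW).2
  let Φ (W : Π y : N, TangentSpace I' y) : TangentSpace I' x :=
    cov W x v - e.symm x (mvfderiv I' (fun y ↦ tangentCoord I' x y (W y)) x v)
  have hΦ : TensorialAt I' E' Φ x :=
    { smul := by
        intro f W hf hW
        have h1 : mvfderiv I' (fun y ↦ tangentCoord I' x y ((f • W) y)) x v
            = f x • mvfderiv I' (fun y ↦ tangentCoord I' x y (W y)) x v
              + mvfderiv I' f x v • tangentCoord I' x x (W x) := by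
          have h2 : (fun y ↦ tangentCoord I' x y ((f • W) y))
              =ᶠ[𝓝 x] f • fun y ↦ tangentCoord I' x y (W y) := by
            filter_upwards [eventually_mem_baseSet (I' := I') x] with y hy
            exact tangentCoord_smul hy _ _
          rw [mvfderiv_congr h2, mvfderiv_smul hf (hd hW)]
          simp
        simp only [Φ]
        rw [h1, symm_add hx, symm_smul hx, symm_smul hx, symm_tangentCoord hx,
          cov.isCovariantDerivativeOnUniv.leibniz hW hf]
        simp only [add_apply, smul_apply,
          ContinuousLinearMap.smulRight_apply]
        module
      add := by
        intro V W hV hW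
        have h1 : mvfderiv I' (fun y ↦ tangentCoord I' x y ((V + W) y)) x v
            = mvfderiv I' (fun y ↦ tangentCoord I' x y (V y)) x v
              + mvfderiv I' (fun y ↦ tangentCoord I' x y (W y)) x v := by
          have h2 : (fun y ↦ tangentCoord I' x y ((V + W) y))
              =ᶠ[𝓝 x] (fun y ↦ tangentCoord I' x y (V y)) + fun y ↦ tangentCoord I' x y (W y) := by
            filter_upwards [eventually_mem_baseSet (I' := I') x] with y hy
            exact tangentCoord_add hy _ _
          rw [mvfderiv_congr h2, mvfderiv_add (hd hV) (hd hW)]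
          simp
        simp only [Φ]
        rw [h1, symm_add hx, cov.isCovariantDerivativeOnUniv.add hV hW]
        simp only [add_apply]
        module }
  -- The extension of u has constant coordinates, so the coordinate derivative vanishes and `Φ`
  -- reduces to `cov`.
  have hext (u : TangentSpace I' x) : Φ (FiberBundle.extend E' u)
      = cov (FiberBundle.extend E' u) x v := by
    have h2 : (fun y ↦ tangentCoord I' x y (FiberBundle.extend E' u y))
        =ᶠ[𝓝 x] fun _ ↦ tangentCoord I' x x u := by
      filter_upwards [eventually_mem_baseSet (I' := I') x] with y hy
      exact tangentCoord_symm hy _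
    simp only [Φ]
    rw [mvfderiv_congr h2, mvfderiv_const]
    have := symm_smul hx (0 : ℝ) (0 : E')
    simp only [zero_smul] at this
    simp [this, he]
  refine ⟨TensorialAt.mkHom Φ x hΦ, fun u ↦ ?_, fun W hW ↦ ?_⟩
  · rw [← hext]
    exact (TensorialAt.mkHom_apply_eq_extend hΦ u).symm
  · have : (TensorialAt.mkHom Φ x hΦ) (W x) = Φ W := TensorialAt.mkHom_apply hΦ hW
    rw [ContinuousLinearMap.coe_coe, this]
    simp [Φ]

lemma covAlong_congr (h : ∀ᶠ q in 𝓝 p, ξ q = η q) (v : TangentSpace I p) :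
    covAlong I cov φ ξ p v = covAlong I cov φ η p v := by
  have h1 : (fun q ↦ (trivializationAt E' (fun x : N ↦ TangentSpace I' x) (φ p) ⟨φ q, ξ q⟩).2)
      =ᶠ[𝓝 p] fun q ↦
        (trivializationAt E' (fun x : N ↦ TangentSpace I' x) (φ p) ⟨φ q, η q⟩).2 := by
    filter_upwards [h] with q hq
    rw [hq]
  simp only [covAlong]
  rw [mvfderiv_congr h1, h.self_of_nhds]

lemma covAlong_eq (ξ : Π p : M, TangentSpace I' (φ p)) (p : M) (v : TangentSpace I p) :
    covAlong I cov φ ξ p v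
      = (trivializationAt E' (TangentSpace I' : N → Type _) (φ p)).symm (φ p)
          (mvfderiv I (fun q ↦ tangentCoord I' (φ p) (φ q) (ξ q)) p v)
        + cov (FiberBundle.extend E' (ξ p)) (φ p) (mfderiv I I' φ p v) := rfl

/-- The connection form `Γ` shows that the second term of `covAlong` is linear in ξ(p); the first is
the derivative of the coordinates. -/
lemma covAlong_add (hξ : IsSmoothAlong I I' φ ξ) (hη : IsSmoothAlong I I' φ η)
    (v : TangentSpace I p) :
    covAlong I cov φ (fun q ↦ ξ q + η q) p v
      = covAlong I cov φ ξ p v + covAlong I cov φ η p v := by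
  obtain ⟨Γ, hΓ, -⟩ := exists_connectionForm cov (φ p) (mfderiv I I' φ p v)
  have hx := FiberBundle.mem_baseSet_trivializationAt' (F := E')
    (E := (TangentSpace I' : N → Type _)) (φ p)
  have h2 : (fun q ↦ tangentCoord I' (φ p) (φ q) (ξ q + η q))
      =ᶠ[𝓝 p] (fun q ↦ tangentCoord I' (φ p) (φ q) (ξ q))
        + fun q ↦ tangentCoord I' (φ p) (φ q) (η q) := by
    filter_upwards [eventually_comp_mem_baseSet hξ.base p] with y hy
    exact tangentCoord_add hy _ _
  simp only [covAlong_eq, hΓ]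
  rw [mvfderiv_congr h2, mvfderiv_add (hξ.mdifferentiableAt_coord p) (hη.mdifferentiableAt_coord p),
    add_apply, symm_add hx, map_add]
  module

lemma covAlong_smul {f : M → ℝ} (hf : ContMDiff I 𝓘(ℝ, ℝ) ∞ f) (hξ : IsSmoothAlong I I' φ ξ)
    (v : TangentSpace I p) :
    covAlong I cov φ (fun q ↦ f q • ξ q) p v
      = mvfderiv I f p v • ξ p + f p • covAlong I cov φ ξ p v := by
  obtain ⟨Γ, hΓ, -⟩ := exists_connectionForm cov (φ p) (mfderiv I I' φ p v)
  have hx := FiberBundle.mem_baseSet_trivializationAt' (F := E')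
    (E := (TangentSpace I' : N → Type _)) (φ p)
  have h2 : (fun q ↦ tangentCoord I' (φ p) (φ q) (f q • ξ q))
      =ᶠ[𝓝 p] f • (fun q ↦ tangentCoord I' (φ p) (φ q) (ξ q)) := by
    filter_upwards [eventually_comp_mem_baseSet hξ.base p] with y hy
    exact tangentCoord_smul hy _ _
  simp only [covAlong_eq, hΓ]
  rw [mvfderiv_congr h2, mvfderiv_smul ((hf p).mdifferentiableAt (by simp))
      (hξ.mdifferentiableAt_coord p), add_apply,
    smul_apply, ContinuousLinearMap.smulRight_apply, symm_add hx, symm_smul hx,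
    symm_smul hx, symm_tangentCoord hx, map_smul]
  module

lemma covAlong_const_smul (c : ℝ) (hξ : IsSmoothAlong I I' φ ξ) (v : TangentSpace I p) :
    covAlong I cov φ (fun q ↦ c • ξ q) p v = c • covAlong I cov φ ξ p v := by
  rw [covAlong_smul cov contMDiff_const hξ, mvfderiv_const]
  simp

lemma covAlong_neg (hξ : IsSmoothAlong I I' φ ξ) (v : TangentSpace I p) :
    covAlong I cov φ (fun q ↦ -ξ q) p v = -covAlong I cov φ ξ p v := by
  simpa using covAlong_const_smul cov (-1) hξ v

lemma covAlong_sub (hξ : IsSmoothAlong I I' φ ξ) (hη : IsSmoothAlong I I' φ η)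
    (v : TangentSpace I p) :
    covAlong I cov φ (fun q ↦ ξ q - η q) p v
      = covAlong I cov φ ξ p v - covAlong I cov φ η p v := by
  have := covAlong_add cov hξ hη.neg v
  rw [covAlong_neg cov hη] at this
  simpa [sub_eq_add_neg] using this

/-- Both sides are a coordinate derivative plus the same `Γ` term, and the coordinate derivatives
agree by the chain rule. This is the base case of every induction over fields along φ. -/
lemma covAlong_comp {W : Π x : N, TangentSpace I' x} (hφ : ContMDiff I I' ∞ φ)
    (hW : IsSmoothField W) (v : TangentSpace I p) :
    covAlong I cov φ (fun q ↦ W (φ q)) p v = cov W (φ p) (mfderiv I I' φ p v) := by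
  obtain ⟨Γ, hΓ, hΓW⟩ := exists_connectionForm cov (φ p) (mfderiv I I' φ p v)
  have hd : MDifferentiableAt I' 𝓘(ℝ, E') (fun y ↦ tangentCoord I' (φ p) y (W y)) (φ p) :=
    ((mdifferentiableAt_totalSpace I' _).1 (hW.mdifferentiableAt (φ p))).2
  rw [hΓW W (hW.mdifferentiableAt _), covAlong_eq, hΓ]
  congr 2
  have := mfderiv_comp_apply p hd ((hφ p).mdifferentiableAt (by simp)) v
  exact this

end CovAlong

/-! ### Lie brackets as commutators, and their images under a differential -/

section Bracket

variable {E : Type*} [NormedAddCommGroup E] [NormedSpace ℝ E] [FiniteDimensional ℝ E]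
  {H : Type*} [TopologicalSpace H] {I : ModelWithCorners ℝ E H}
  {M : Type*} [TopologicalSpace M] [ChartedSpace H M] [IsManifold I ∞ M]
  {E' : Type*} [NormedAddCommGroup E'] [NormedSpace ℝ E'] [FiniteDimensional ℝ E']
  {H' : Type*} [TopologicalSpace H'] {I' : ModelWithCorners ℝ E' H'}
  {N : Type*} [TopologicalSpace N] [ChartedSpace H' N] [IsManifold I' ∞ N]
  {φ : M → N} {X Y : Π p : M, TangentSpace I p} {p : M}

lemma mdifferentiableAt_mlieBracket (hX : IsSmoothField X) (hY : IsSmoothField Y) (p : M) :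
    MDifferentiableAt I I.tangent (fun y ↦ (⟨y, mlieBracket I X Y y⟩ : TangentBundle I M)) p := by
  have : IsManifold I ((2 : ℕ∞) + 1) M := IsManifold.of_le (n := ∞) (by exact_mod_cast le_top)
  have : IsManifold I (minSmoothness ℝ 2) M := by
    rw [minSmoothness_of_isRCLikeNormedField]
    infer_instance
  have h2 : ContMDiffAt I I.tangent ((1 : ℕ∞) : WithTop ℕ∞)
      (fun y ↦ (⟨y, mlieBracket I X Y y⟩ : TangentBundle I M)) p :=
    ContMDiffAt.mlieBracket_vectorField (m := 1) (n := 2)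
      ((hX p).of_le (by exact_mod_cast le_top)) ((hY p).of_le (by exact_mod_cast le_top))
      (by simp; norm_num)
  exact h2.mdifferentiableAt (by simp)

variable [T2Space M]

/-- The Lie bracket acts on functions as the commutator of the derivations. -/
theorem mvfderiv_mlieBracket {f : M → ℝ} (hf : ContMDiff I 𝓘(ℝ, ℝ) ∞ f) (hX : IsSmoothField X)
    (hY : IsSmoothField Y) (p : M) :
    mvfderiv I f p (mlieBracket I X Y p)
      = mvfderiv I (fun q ↦ mvfderiv I f q (Y q)) p (X p)
        - mvfderiv I (fun q ↦ mvfderiv I f q (X q)) p (Y p) := by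
  -- The argument below tests against a field W with W(p) ≠ 0, which needs a nonzero tangent space.
  by_cases htriv : ∀ v : TangentSpace I p, v = 0
  · rw [htriv (X p), htriv (Y p), htriv (mlieBracket I X Y p)]
    simp
  push Not at htriv
  obtain ⟨v, hv⟩ := htriv
  obtain ⟨W, hW, hWp⟩ := exists_isSmoothField_eq p v
  have hfd (q) : MDifferentiableAt I 𝓘(ℝ, ℝ) f q := (hf q).mdifferentiableAt (by simp)
  have hbr {Z : Π p : M, TangentSpace I p} (hZ : IsSmoothField Z) :
      mlieBracket I Z (f • W) = (fun q ↦ mvfderiv I f q (Z q)) • W + f • mlieBracket I Z W := by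
    ext1 q
    exact mlieBracket_smul_right (hfd q) (hW.mdifferentiableAt q)
  have hZf {Z : Π p : M, TangentSpace I p} (hZ : IsSmoothField Z) :
      MDifferentiableAt I 𝓘(ℝ, ℝ) (fun q ↦ mvfderiv I f q (Z q)) p :=
    (contMDiff_mvfderiv hf hZ p).mdifferentiableAt (by simp)
  have hsm {g : M → ℝ} {Z : Π p : M, TangentSpace I p} (hg : MDifferentiableAt I 𝓘(ℝ, ℝ) g p)
      (hZ : MDifferentiableAt I I.tangent (fun y ↦ (⟨y, Z y⟩ : TangentBundle I M)) p) :
      MDifferentiableAt I I.tangent (fun y ↦ (⟨y, (g • Z) y⟩ : TangentBundle I M)) p :=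
    hg.smul_section hZ
  have hexp {U Z : Π p : M, TangentSpace I p} (hU : IsSmoothField U) (hZ : IsSmoothField Z) :
      mlieBracket I U (mlieBracket I Z (f • W)) p
        = mvfderiv I (fun q ↦ mvfderiv I f q (Z q)) p (U p) • W p
          + mvfderiv I f p (Z p) • mlieBracket I U W p
          + (mvfderiv I f p (U p) • mlieBracket I Z W p
            + f p • mlieBracket I U (mlieBracket I Z W) p) := by
    rw [hbr hZ, mlieBracket_add_right (hsm (hZf hZ) (hW.mdifferentiableAt p))
      (hsm (hfd p) (mdifferentiableAt_mlieBracket hZ hW p)),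
      mlieBracket_smul_right (hZf hZ) (hW.mdifferentiableAt p),
      mlieBracket_smul_right (hfd p) (mdifferentiableAt_mlieBracket hZ hW p)]
  have : IsManifold I (minSmoothness ℝ 3) M := by
    rw [minSmoothness_of_isRCLikeNormedField]
    infer_instance
  have h2 : minSmoothness ℝ 2 ≤ (∞ : WithTop ℕ∞) := by
    rw [minSmoothness_of_isRCLikeNormedField]
    exact ENat.LEInfty.out
  -- The Jacobi identity for X, Y, fW minus f(p) times the one for X, Y, W leaves a multiple of
  -- W(p), whose coefficient is the difference of the two sides of the claim.
  have hJ := leibniz_identity_mlieBracket_apply ((hX p).of_le h2) ((hY p).of_le h2)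
    ((IsSmoothAlong.smul (φ := id) hf hW.isSmoothAlong_id p).of_le h2)
  have hJW := leibniz_identity_mlieBracket_apply ((hX p).of_le h2) ((hY p).of_le h2)
    ((hW p).of_le h2)
  change mlieBracket I X (mlieBracket I Y (f • W)) p = mlieBracket I (mlieBracket I X Y) (f • W) p
    + mlieBracket I Y (mlieBracket I X (f • W)) p at hJ
  rw [hexp hX hY, hexp hY hX, mlieBracket_smul_right (hfd p) (hW.mdifferentiableAt p), hJW] at hJ
  have h0 : (mvfderiv I f p (mlieBracket I X Y p)
      - (mvfderiv I (fun q ↦ mvfderiv I f q (Y q)) p (X p)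
        - mvfderiv I (fun q ↦ mvfderiv I f q (X q)) p (Y p))) • W p = 0 := by
    rw [← sub_eq_zero] at hJ
    rw [← neg_eq_zero, ← hJ]
    module
  rw [hWp] at h0
  exact sub_eq_zero.1 ((smul_eq_zero.1 h0).resolve_right hv)

/-- The coordinates of `dφ [X, Y]` in the trivialization of `TN` around `φ p`. -/
theorem tangentCoord_mfderiv_mlieBracket [T2Space N] (hφ : ContMDiff I I' ∞ φ)
    (hX : IsSmoothField X) (hY : IsSmoothField Y) (p : M) :
    mvfderiv I (fun q ↦ tangentCoord I' (φ p) (φ q) (mfderiv I I' φ q (Y q))) p (X p)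
      - mvfderiv I (fun q ↦ tangentCoord I' (φ p) (φ q) (mfderiv I I' φ q (X q))) p (Y p)
      = tangentCoord I' (φ p) (φ p) (mfderiv I I' φ p (mlieBracket I X Y p)) := by
  have hchart : ∀ᶠ x in 𝓝 (φ p), x ∈ (chartAt H' (φ p)).source :=
    (chartAt H' (φ p)).open_source.mem_nhds (mem_chart_source H' (φ p))
  -- The trivialization of TN around φ p is the differential of the chart there, so tangent
  -- coordinates are derivatives of chart components.
  have hcoord {x : N} (hx : x ∈ (chartAt H' (φ p)).source) (v : TangentSpace I' x) :
      tangentCoord I' (φ p) x v = mvfderiv I' (extChartAt I' (φ p)) x v := by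
    have h1 := TangentBundle.continuousLinearMapAt_trivializationAt (I := I') hx
    have h2 : tangentCoord I' (φ p) x v
        = (trivializationAt E' (TangentSpace I') (φ p)).continuousLinearMapAt ℝ x v := by
      rw [Trivialization.continuousLinearMapAt_apply, Trivialization.coe_linearMapAt_of_mem]
      · rfl
      · exact hx
    rw [h2, h1]
    rfl
  refine (finBasis ℝ E').ext_elem fun i ↦ ?_
  let ℓ : E' →L[ℝ] ℝ := ((finBasis ℝ E').coord i).toContinuousLinearMap
  change ℓ _ = ℓ _
  -- A chart component, made global by a cutoff; the claim for this component is then the commutator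
  -- formula for g ∘ φ on M.
  obtain ⟨g, hg, hge⟩ := exists_contMDiff_eventuallyEq (I := I') (p := φ p)
    (f := fun x ↦ ℓ (extChartAt I' (φ p) x)) (by
      filter_upwards [hchart] with x hx
      exact ℓ.contMDiff.contMDiffAt.comp x (contMDiffAt_extChartAt' hx))
  have hgd : ∀ᶠ x in 𝓝 (φ p), ∀ v : TangentSpace I' x,
      ℓ (tangentCoord I' (φ p) x v) = mvfderiv I' g x v := by
    filter_upwards [hchart, hge.eventually_nhds] with x hx hgx v
    rw [mvfderiv_congr hgx, hcoord hx]
    exact (mfderiv_comp_apply x ℓ.mdifferentiableAt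
      ((contMDiffAt_extChartAt' (n := ∞) hx).mdifferentiableAt (by simp)) v).symm ▸ by
        rw [ℓ.mfderiv_eq]; rfl
  have hcomp (q : M) (v : TangentSpace I q) :
      mvfderiv I (fun q ↦ g (φ q)) q v = mvfderiv I' g (φ q) (mfderiv I I' φ q v) :=
    mfderiv_comp_apply q ((hg _).mdifferentiableAt (by simp)) ((hφ q).mdifferentiableAt (by simp)) v
  have hkey {Z : Π p : M, TangentSpace I p} (hZ : IsSmoothField Z) (v : TangentSpace I p) :
      ℓ (mvfderiv I (fun q ↦ tangentCoord I' (φ p) (φ q) (mfderiv I I' φ q (Z q))) p v)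
        = mvfderiv I (fun q ↦ mvfderiv I (fun q ↦ g (φ q)) q (Z q)) p v := by
    have h1 : (fun q ↦ mvfderiv I (fun q ↦ g (φ q)) q (Z q)) =ᶠ[𝓝 p]
        fun q ↦ ℓ (tangentCoord I' (φ p) (φ q) (mfderiv I I' φ q (Z q))) := by
      filter_upwards [hφ.continuous.continuousAt.eventually hgd] with q hq
      rw [hcomp, hq]
    rw [mvfderiv_congr h1]
    exact (mfderiv_comp_apply p ℓ.mdifferentiableAt
      ((IsSmoothAlong.mfderiv hφ hZ).mdifferentiableAt_coord p) v).symm ▸ by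
        rw [ℓ.mfderiv_eq]; rfl
  rw [map_sub, hkey hX, hkey hY, hgd.self_of_nhds]
  refine (mvfderiv_mlieBracket (hg.comp hφ) hX hY p).symm.trans ?_
  exact hcomp p _

end Bracket

/-! ### The pulled back connection: smoothness, torsion, J and the metric -/

section LeviCivitaAlong

variable {E : Type*} [NormedAddCommGroup E] [NormedSpace ℝ E] [FiniteDimensional ℝ E]
  {H : Type*} [TopologicalSpace H] {I : ModelWithCorners ℝ E H}
  {M : Type*} [TopologicalSpace M] [ChartedSpace H M] [IsManifold I ∞ M] [T2Space M]
  {E' : Type*} [NormedAddCommGroup E'] [NormedSpace ℝ E'] [FiniteDimensional ℝ E']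
  {H' : Type*} [TopologicalSpace H'] {I' : ModelWithCorners ℝ E' H'}
  {N : Type*} [TopologicalSpace N] [ChartedSpace H' N] [IsManifold I' ∞ N] [T2Space N]
  {φ : M → N} {ξ η : Π p : M, TangentSpace I' (φ p)} {X Y : Π p : M, TangentSpace I p} {p : M}
  {cov : CovariantDerivative I' E' (fun x : N ↦ TangentSpace I' x)}

lemma isSmoothAlong_cov_apply (hcov : CovariantDerivative.ContMDiffCovariantDerivative cov ∞)
    {W : Π x : N, TangentSpace I' x} (hW : IsSmoothField W) (hξ : IsSmoothAlong I I' φ ξ) :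
    IsSmoothAlong I I' φ (fun q ↦ cov W (φ q) (ξ q)) := by
  have h1 : ContMDiff I' (I'.prod 𝓘(ℝ, E' →L[ℝ] E')) ∞
      (fun x ↦ (⟨x, cov W x⟩ : TotalSpace (E' →L[ℝ] E')
        (fun x : N ↦ TangentSpace I' x →L[ℝ] TangentSpace I' x))) :=
    contMDiffOn_univ.1 (hcov.contMDiff.contMDiff (σ := W) (contMDiffOn_univ.2 hW))
  exact ContMDiff.clm_bundle_apply (b := φ) (ϕ := fun q ↦ cov W (φ q)) (h1.comp hξ.base) hξ

lemma isSmoothField_cov (hcov : CovariantDerivative.ContMDiffCovariantDerivative cov ∞)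
    {V W : Π x : N, TangentSpace I' x} (hW : IsSmoothField W) (hV : IsSmoothField V) :
    IsSmoothField (fun x ↦ cov W x (V x)) :=
  isSmoothAlong_cov_apply (φ := (id : N → N)) (I := I') hcov hW hV

/-- For W ∘ φ the derivative is `cov W` applied to dφ X, smooth because `cov` is; the Leibniz rule
extends this to combinations. The induction runs on a local form of the statement, agreement near p
with some smooth field. -/
lemma isSmoothAlong_covAlong (hcov : CovariantDerivative.ContMDiffCovariantDerivative cov ∞)
    (hξ : IsSmoothAlong I I' φ ξ) (hX : IsSmoothField X) :
    IsSmoothAlong I I' φ (fun q ↦ covAlong I cov φ ξ q (X q)) := by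
  have hφ := hξ.base
  refine isSmoothAlong_of_eventuallyEq fun p ↦ ?_
  refine IsSmoothAlong.induction hφ p
    (P := fun ξ ↦ ∃ ζ, IsSmoothAlong I I' φ ζ ∧ ∀ᶠ q in 𝓝 p, covAlong I cov φ ξ q (X q) = ζ q)
    ?_ ?_ ?_ ?_ hξ
  · rintro ξ η - - h ⟨ζ, hζ, h'⟩
    refine ⟨ζ, hζ, ?_⟩
    filter_upwards [h.eventually_nhds, h'] with q hq hq'
    rw [covAlong_congr cov hq, hq']
  · rintro ξ η hξ hη ⟨ζ, hζ, h⟩ ⟨ζ', hζ', h'⟩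
    refine ⟨_, hζ.add hζ', ?_⟩
    filter_upwards [h, h'] with q hq hq'
    rw [covAlong_add cov hξ hη, hq, hq']
  · rintro f ξ hf hξ ⟨ζ, hζ, h⟩
    refine ⟨_, (hξ.smul (contMDiff_mvfderiv hf hX)).add (hζ.smul hf), ?_⟩
    filter_upwards [h] with q hq
    rw [covAlong_smul cov hf hξ, hq]
  · intro W hW
    exact ⟨_, isSmoothAlong_cov_apply hcov hW (IsSmoothAlong.mfderiv hφ hX),
      .of_forall fun q ↦ covAlong_comp cov hφ hW _⟩

/-- The Lie bracket of two fields with constant coordinates around `x` vanishes at `x`. -/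
lemma mlieBracket_extend_extend (x : N) (u v : TangentSpace I' x) :
    mlieBracket I' (FiberBundle.extend E' u) (FiberBundle.extend E' v) x = 0 := by
  obtain ⟨U, hU, hUe⟩ := exists_isSmoothField_extend I' x u
  obtain ⟨V, hV, hVe⟩ := exists_isSmoothField_extend I' x v
  rw [← Filter.EventuallyEq.mlieBracket_vectorField_eq hUe hVe]
  have hconst {W : Π y : N, TangentSpace I' y} {w : TangentSpace I' x}
      (hW : ∀ᶠ y in 𝓝 x, W y = FiberBundle.extend E' w y) (v : TangentSpace I' x) :
      mvfderiv I' (fun y ↦ tangentCoord I' x y (mfderiv I' I' id y (W y))) x v = 0 := by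
    have h : (fun y ↦ tangentCoord I' x y (mfderiv I' I' id y (W y)))
        =ᶠ[𝓝 x] fun _ ↦ tangentCoord I' x x w := by
      filter_upwards [hW, eventually_mem_baseSet (I' := I') x] with y hy hy'
      rw [mfderiv_id, hy]
      exact tangentCoord_symm hy' _
    rw [mvfderiv_congr h, mvfderiv_const]
    simp
  -- For φ = id the coordinates of the bracket are a difference of derivatives of constant
  -- coordinates.
  have h := tangentCoord_mfderiv_mlieBracket (φ := (id : N → N)) contMDiff_id hU hV x
  have h' : tangentCoord I' x x (mfderiv I' I' id x (mlieBracket I' U V x)) = 0 :=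
    h.symm.trans ((congrArg₂ (· - ·) (hconst hVe (U x)) (hconst hUe (V x))).trans (sub_zero 0))
  rw [mfderiv_id] at h'
  have hx := FiberBundle.mem_baseSet_trivializationAt' (F := E')
    (E := (TangentSpace I' : N → Type _)) x
  have h0 := symm_smul hx (0 : ℝ) (0 : E')
  rw [zero_smul, zero_smul] at h0
  rw [← symm_tangentCoord hx (mlieBracket I' U V x), ← h0]
  exact congrArg _ h'

/-- The symmetry of the Christoffel symbols: the bracket term in the torsion vanishes on fields with
constant coordinates. -/
lemma cov_extend_comm (htor : cov.torsion = 0) (x : N) (u v : TangentSpace I' x) :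
    cov (FiberBundle.extend E' u) x v = cov (FiberBundle.extend E' v) x u := by
  have h := CovariantDerivative.torsion_apply_eq_extend cov v u
  rw [htor, mlieBracket_extend_extend] at h
  rw [sub_zero, FiberBundle.extend_apply_self, FiberBundle.extend_apply_self] at h
  exact sub_eq_zero.1 h.symm

/-- The pulled back connection is torsion free. -/
lemma covAlong_mfderiv_sub (htor : cov.torsion = 0) (hφ : ContMDiff I I' ∞ φ)
    (hX : IsSmoothField X) (hY : IsSmoothField Y) (p : M) :
    covAlong I cov φ (fun q ↦ mfderiv I I' φ q (Y q)) p (X p)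
      - covAlong I cov φ (fun q ↦ mfderiv I I' φ q (X q)) p (Y p)
      = mfderiv I I' φ p (mlieBracket I X Y p) := by
  have hx := FiberBundle.mem_baseSet_trivializationAt' (F := E')
    (E := (TangentSpace I' : N → Type _)) (φ p)
  -- The Christoffel terms cancel by symmetry; the coordinate derivatives left over are the
  -- coordinates of dφ [X, Y].
  rw [covAlong_eq, covAlong_eq, cov_extend_comm htor, add_sub_add_right_eq_sub,
    ← symm_tangentCoord hx (mfderiv I I' φ p (mlieBracket I X Y p)),
    ← tangentCoord_mfderiv_mlieBracket hφ hX hY p, sub_eq_add_neg, sub_eq_add_neg,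
    symm_add hx, ← neg_one_smul ℝ, ← symm_smul hx, neg_one_smul]

lemma isSmoothAlong_apply {J : Π x : N, TangentSpace I' x →L[ℝ] TangentSpace I' x}
    (hJ : ContMDiff I' (I'.prod 𝓘(ℝ, E' →L[ℝ] E')) ∞
      (fun x ↦ (⟨x, J x⟩ : TotalSpace (E' →L[ℝ] E')
        (fun x : N ↦ TangentSpace I' x →L[ℝ] TangentSpace I' x))))
    (hξ : IsSmoothAlong I I' φ ξ) : IsSmoothAlong I I' φ (fun q ↦ J (φ q) (ξ q)) :=
  ContMDiff.clm_bundle_apply (b := φ) (ϕ := fun q ↦ J (φ q)) (hJ.comp hξ.base) hξ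

variable [RiemannianBundle (fun x : N ↦ TangentSpace I' x)]

lemma covAlong_kaehler {J : Π x : N, TangentSpace I' x →L[ℝ] TangentSpace I' x}
    (hJ : IsKaehlerStructure cov J) (hξ : IsSmoothAlong I I' φ ξ) (p : M) (v : TangentSpace I p) :
    covAlong I cov φ (fun q ↦ J (φ q) (ξ q)) p v = J (φ p) (covAlong I cov φ ξ p v) := by
  have hφ := hξ.base
  refine IsSmoothAlong.induction hφ p (P := fun ξ ↦
    covAlong I cov φ (fun q ↦ J (φ q) (ξ q)) p v = J (φ p) (covAlong I cov φ ξ p v))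
    ?_ ?_ ?_ ?_ hξ
  · intro ξ η _ _ h hξ
    rw [covAlong_congr cov h, ← hξ]
    refine covAlong_congr cov ?_ v
    filter_upwards [h] with q hq
    rw [hq]
  · intro ξ η hξ hη h h'
    simp only [map_add]
    rw [covAlong_add cov (isSmoothAlong_apply hJ.smooth hξ) (isSmoothAlong_apply hJ.smooth hη),
      covAlong_add cov hξ hη, map_add, h, h']
  · intro f ξ hf hξ h
    simp only [map_smul]
    rw [covAlong_smul cov hf (isSmoothAlong_apply hJ.smooth hξ), covAlong_smul cov hf hξ, h]
    simp
  · intro W hW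
    have hJW : IsSmoothField (fun x ↦ J x (W x)) :=
      isSmoothAlong_apply (φ := (id : N → N)) (I := I') hJ.smooth hW
    rw [covAlong_comp cov hφ hJW, covAlong_comp cov hφ hW, hJ.parallel W hW]

variable [IsContMDiffRiemannianBundle I' ∞ E' (fun x : N ↦ TangentSpace I' x)]

lemma IsSmoothAlong.inner (hξ : IsSmoothAlong I I' φ ξ) (hη : IsSmoothAlong I I' φ η) :
    ContMDiff I 𝓘(ℝ, ℝ) ∞ (fun q ↦ ⟪ξ q, η q⟫) :=
  ContMDiff.inner_bundle hξ hη

/-- Induction on ξ and then on η reduces to restrictions of two ambient fields, where it is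
metricity of `cov` and the chain rule. -/
lemma mvfderiv_inner_along (hcov : IsLeviCivita cov) (hξ : IsSmoothAlong I I' φ ξ)
    (hη : IsSmoothAlong I I' φ η) (p : M) (v : TangentSpace I p) :
    mvfderiv I (fun q ↦ ⟪ξ q, η q⟫) p v
      = ⟪covAlong I cov φ ξ p v, η p⟫ + ⟪ξ p, covAlong I cov φ η p v⟫ := by
  have hφ := hξ.base
  have hd {ξ η : Π p : M, TangentSpace I' (φ p)} (hξ : IsSmoothAlong I I' φ ξ)
      (hη : IsSmoothAlong I I' φ η) :
      MDifferentiableAt I 𝓘(ℝ, ℝ) (fun q ↦ ⟪ξ q, η q⟫) p :=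
    (hξ.inner hη p).mdifferentiableAt (by simp)
  refine IsSmoothAlong.induction hφ p (P := fun ξ ↦ mvfderiv I (fun q ↦ ⟪ξ q, η q⟫) p v
      = ⟪covAlong I cov φ ξ p v, η p⟫ + ⟪ξ p, covAlong I cov φ η p v⟫) ?_ ?_ ?_ ?_ hξ
  · intro ξ ζ _ _ h h'
    rw [covAlong_congr cov h, h.self_of_nhds, ← h']
    refine mvfderiv_congr ?_ v
    filter_upwards [h] with q hq
    rw [hq]
  · intro ξ ζ hξ hζ h h'
    simp only [inner_add_left]
    rw [mvfderiv_fun_add (hd hξ hη) (hd hζ hη), covAlong_add cov hξ hζ, add_apply, h, h',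
      inner_add_left]
    ring
  · intro f ξ hf hξ h
    simp only [real_inner_smul_left]
    rw [mvfderiv_fun_mul ((hf p).mdifferentiableAt (by simp)) (hd hξ hη), covAlong_smul cov hf hξ,
      add_apply, smul_apply, smul_apply, h]
    simp only [inner_add_left, real_inner_smul_left, smul_eq_mul]
    ring
  · intro W hW
    have hWφ := hW.isSmoothAlong hφ
    refine IsSmoothAlong.induction hφ p (P := fun η ↦ mvfderiv I (fun q ↦ ⟪W (φ q), η q⟫) p v
      = ⟪covAlong I cov φ (fun q ↦ W (φ q)) p v, η p⟫ + ⟪W (φ p), covAlong I cov φ η p v⟫)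
      ?_ ?_ ?_ ?_ hη
    · intro ξ ζ _ _ h h'
      rw [covAlong_congr cov h, h.self_of_nhds, ← h']
      refine mvfderiv_congr ?_ v
      filter_upwards [h] with q hq
      rw [hq]
    · intro ξ ζ hξ hζ h h'
      simp only [inner_add_right]
      rw [mvfderiv_fun_add (hd hWφ hξ) (hd hWφ hζ), covAlong_add cov hξ hζ, add_apply, h, h',
        inner_add_right]
      ring
    · intro f ξ hf hξ h
      simp only [real_inner_smul_right]
      rw [mvfderiv_fun_mul ((hf p).mdifferentiableAt (by simp)) (hd hWφ hξ),
        covAlong_smul cov hf hξ, add_apply, smul_apply, smul_apply, h]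
      simp only [inner_add_right, real_inner_smul_right, smul_eq_mul]
      ring
    · intro V hV
      rw [covAlong_comp cov hφ hV, covAlong_comp cov hφ hW, ← hcov.metric W V (φ p)
        (hW.mdifferentiableAt _) (hV.mdifferentiableAt _)]
      exact mfderiv_comp_apply p
        (((IsSmoothAlong.inner (φ := (id : N → N)) (I := I') hW hV) (φ p)).mdifferentiableAt
          (by simp)) ((hφ p).mdifferentiableAt (by simp)) v

end LeviCivitaAlong

/-! ### Curvature of the pulled back connection -/

section Curvature

variable {E : Type*} [NormedAddCommGroup E] [NormedSpace ℝ E] [FiniteDimensional ℝ E]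
  {H : Type*} [TopologicalSpace H] {I : ModelWithCorners ℝ E H}
  {M : Type*} [TopologicalSpace M] [ChartedSpace H M] [IsManifold I ∞ M] [T2Space M]
  {E' : Type*} [NormedAddCommGroup E'] [NormedSpace ℝ E'] [FiniteDimensional ℝ E']
  {H' : Type*} [TopologicalSpace H'] {I' : ModelWithCorners ℝ E' H'}
  {N : Type*} [TopologicalSpace N] [ChartedSpace H' N] [IsManifold I' ∞ N] [T2Space N]
  {φ : M → N} {ξ η : Π p : M, TangentSpace I' (φ p)} {X Y : Π p : M, TangentSpace I p} {p : M}
  {cov : CovariantDerivative I' E' (fun x : N ↦ TangentSpace I' x)}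

variable (cov) in
/-- The curvature of the connection pulled back to the fields along `φ`. -/
noncomputable def curvatureAlong (φ : M → N) (X Y : Π p : M, TangentSpace I p)
    (ξ : Π p : M, TangentSpace I' (φ p)) (p : M) : TangentSpace I' (φ p) :=
  covAlong I cov φ (fun q ↦ covAlong I cov φ ξ q (Y q)) p (X p)
    - covAlong I cov φ (fun q ↦ covAlong I cov φ ξ q (X q)) p (Y p)
    - covAlong I cov φ ξ p (mlieBracket I X Y p)

section SecondDerivative

/-- The second covariant derivative of a vector field, in a fixed first direction. -/
lemma exists_secondCovariantDerivative
    (hcov : CovariantDerivative.ContMDiffCovariantDerivative cov ∞)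
    {W : Π x : N, TangentSpace I' x} (hW : IsSmoothField W) (x : N) (u : TangentSpace I' x) :
    ∃ S : TangentSpace I' x →ₗ[ℝ] TangentSpace I' x, ∀ V : Π y : N, TangentSpace I' y,
      IsSmoothField V → cov (fun y ↦ cov W y (V y)) x u = cov W x (cov V x u) + S (V x) := by
  suffices h : ∃ S : TangentSpace I' x →ₗ[ℝ] TangentSpace I' x, ∀ V : Π y : N, TangentSpace I' y,
      IsSmoothAlong I' I' id V → cov (fun y ↦ cov W y (V y)) x u - cov W x (cov V x u) = S (V x) by
    obtain ⟨S, hS⟩ := h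
    exact ⟨S, fun V hV ↦ by rw [← hS V hV]; module⟩
  refine exists_linearMap_of_tensorial (I := I') (φ := (id : N → N)) contMDiff_id x
    (Φ := fun V ↦ cov (fun y ↦ cov W y (V y)) x u - cov W x (cov V x u)) ?_ ?_ ?_
  · intro V V' hV hV' h
    have h1 := cov.isCovariantDerivativeOnUniv.congr_of_eventuallyEq
      (IsSmoothField.mdifferentiableAt hV' x) (IsSmoothField.mdifferentiableAt hV x)
      Filter.univ_mem h
    have h2 := cov.isCovariantDerivativeOnUniv.congr_of_eventuallyEq
      ((isSmoothField_cov hcov hW hV').mdifferentiableAt x)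
      ((isSmoothField_cov hcov hW hV).mdifferentiableAt x)
      Filter.univ_mem (by filter_upwards [h] with y hy; simp only [id] at hy; rw [hy])
    change cov.toFun V' x = cov.toFun V x at h1
    rw [h1, h2]
  · intro V V' hV hV'
    have h1 := cov.isCovariantDerivativeOnUniv.add
      (IsSmoothField.mdifferentiableAt hV x) (IsSmoothField.mdifferentiableAt hV' x)
    have h2 := cov.isCovariantDerivativeOnUniv.add
      ((isSmoothField_cov hcov hW hV).mdifferentiableAt x)
      ((isSmoothField_cov hcov hW hV').mdifferentiableAt x)
    simp only [map_add]
    change cov.toFun (fun y ↦ V y + V' y) x = _ at h1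
    change cov.toFun (fun y ↦ cov.toFun W y (V y) + cov.toFun W y (V' y)) x = _ at h2
    rw [h1, h2]
    simp only [add_apply, map_add]
    module
  · intro f V hf hV
    have hfd : MDifferentiableAt I' 𝓘(ℝ, ℝ) f x := (hf x).mdifferentiableAt (by simp)
    have h1 := cov.isCovariantDerivativeOnUniv.leibniz
      (IsSmoothField.mdifferentiableAt hV x) hfd
    have h2 := cov.isCovariantDerivativeOnUniv.leibniz
      ((isSmoothField_cov hcov hW hV).mdifferentiableAt x) hfd
    simp only [map_smul]
    change cov.toFun (fun y ↦ f y • V y) x = _ at h1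
    change cov.toFun (fun y ↦ f y • cov.toFun W y (V y)) x = _ at h2
    rw [h1, h2]
    simp only [add_apply, smul_apply, ContinuousLinearMap.smulRight_apply, map_add, map_smul]
    module

/-- Carries the formula for the second derivative of W from ambient fields V to fields along φ; it
is needed for dφ X, which need not be a restriction. -/
lemma covAlong_cov_apply (hcov : CovariantDerivative.ContMDiffCovariantDerivative cov ∞)
    {W : Π x : N, TangentSpace I' x} (hW : IsSmoothField W) (hξ : IsSmoothAlong I I' φ ξ)
    {p : M} {v : TangentSpace I p} {S : TangentSpace I' (φ p) →ₗ[ℝ] TangentSpace I' (φ p)}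
    (hS : ∀ V : Π y : N, TangentSpace I' y, IsSmoothField V →
      cov (fun y ↦ cov W y (V y)) (φ p) (mfderiv I I' φ p v)
        = cov W (φ p) (cov V (φ p) (mfderiv I I' φ p v)) + S (V (φ p))) :
    covAlong I cov φ (fun q ↦ cov W (φ q) (ξ q)) p v
      = cov W (φ p) (covAlong I cov φ ξ p v) + S (ξ p) := by
  have hφ := hξ.base
  refine IsSmoothAlong.induction hφ p (P := fun ξ ↦
    covAlong I cov φ (fun q ↦ cov W (φ q) (ξ q)) p v
      = cov W (φ p) (covAlong I cov φ ξ p v) + S (ξ p)) ?_ ?_ ?_ ?_ hξ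
  · intro ξ η _ _ h hξ
    rw [covAlong_congr cov h, h.self_of_nhds, ← hξ]
    refine covAlong_congr cov ?_ v
    filter_upwards [h] with q hq
    rw [hq]
  · intro ξ η hξ hη h h'
    simp only [map_add]
    rw [covAlong_add cov (isSmoothAlong_cov_apply hcov hW hξ) (isSmoothAlong_cov_apply hcov hW hη),
      covAlong_add cov hξ hη, map_add, h, h']
    module
  · intro f ξ hf hξ h
    simp only [map_smul]
    rw [covAlong_smul cov hf (isSmoothAlong_cov_apply hcov hW hξ), covAlong_smul cov hf hξ, h]
    simp only [map_add, map_smul]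
    module
  · intro V hV
    rw [covAlong_comp cov hφ (isSmoothField_cov hcov hW hV), covAlong_comp cov hφ hV, hS V hV]

end SecondDerivative

/-- In each curvature the terms with a first derivative of W cancel by vanishing torsion. What
remains on both sides is the skew part of the second derivative of W, which depends only on the
values dφ X and dφ Y at p. -/
lemma curvatureAlong_comp (hcov : CovariantDerivative.ContMDiffCovariantDerivative cov ∞)
    (htor : cov.torsion = 0) (hφ : ContMDiff I I' ∞ φ) (hX : IsSmoothField X)
    (hY : IsSmoothField Y) {U V W : Π x : N, TangentSpace I' x} (hU : IsSmoothField U)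
    (hV : IsSmoothField V) (hW : IsSmoothField W)
    (hUX : U (φ p) = mfderiv I I' φ p (X p)) (hVY : V (φ p) = mfderiv I I' φ p (Y p)) :
    curvatureAlong cov φ X Y (fun q ↦ W (φ q)) p = affineCurvature cov U V W (φ p) := by
  obtain ⟨S, hS⟩ := exists_secondCovariantDerivative hcov hW (φ p) (mfderiv I I' φ p (X p))
  obtain ⟨T, hT⟩ := exists_secondCovariantDerivative hcov hW (φ p) (mfderiv I I' φ p (Y p))
  have h1 := congrArg (cov W (φ p)) (covAlong_mfderiv_sub htor hφ hX hY p)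
  have h2 := congrArg (cov W (φ p)) (CovariantDerivative.torsion_eq_zero_iff cov |>.1 htor
    (hU.mdifferentiableAt (φ p)) (hV.mdifferentiableAt (φ p)))
  rw [map_sub] at h1 h2
  simp only [curvatureAlong, affineCurvature]
  simp only [covAlong_comp cov hφ hW]
  rw [covAlong_cov_apply hcov hW (IsSmoothAlong.mfderiv hφ hY) hS,
    covAlong_cov_apply hcov hW (IsSmoothAlong.mfderiv hφ hX) hT, hUX, hVY, hS V hV, hT U hU,
    hUX, hVY, ← h1, ← h2, hUX, hVY]
  module

lemma curvatureAlong_congr (h : ∀ᶠ q in 𝓝 p, ξ q = η q) :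
    curvatureAlong cov φ X Y ξ p = curvatureAlong cov φ X Y η p := by
  have h1 (Z : Π p : M, TangentSpace I p) :
      ∀ᶠ q in 𝓝 p, covAlong I cov φ ξ q (Z q) = covAlong I cov φ η q (Z q) := by
    filter_upwards [h.eventually_nhds] with q hq
    exact covAlong_congr cov hq _
  simp only [curvatureAlong]
  rw [covAlong_congr cov h, covAlong_congr cov (h1 X), covAlong_congr cov (h1 Y)]

lemma curvatureAlong_add (hcov : CovariantDerivative.ContMDiffCovariantDerivative cov ∞)
    (hX : IsSmoothField X) (hY : IsSmoothField Y)
    (hξ : IsSmoothAlong I I' φ ξ) (hη : IsSmoothAlong I I' φ η) :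
    curvatureAlong cov φ X Y (fun q ↦ ξ q + η q) p
      = curvatureAlong cov φ X Y ξ p + curvatureAlong cov φ X Y η p := by
  simp only [curvatureAlong]
  simp only [covAlong_add cov hξ hη]
  rw [covAlong_add cov (isSmoothAlong_covAlong hcov hξ hY) (isSmoothAlong_covAlong hcov hη hY),
    covAlong_add cov (isSmoothAlong_covAlong hcov hξ hX) (isSmoothAlong_covAlong hcov hη hX)]
  module

/-- The mixed terms are symmetric in X and Y, and the second derivatives of f cancel against [X,
Y]f. -/
lemma curvatureAlong_smul (hcov : CovariantDerivative.ContMDiffCovariantDerivative cov ∞)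
    (hX : IsSmoothField X) (hY : IsSmoothField Y) {f : M → ℝ} (hf : ContMDiff I 𝓘(ℝ, ℝ) ∞ f)
    (hξ : IsSmoothAlong I I' φ ξ) :
    curvatureAlong cov φ X Y (fun q ↦ f q • ξ q) p = f p • curvatureAlong cov φ X Y ξ p := by
  have hexp {Z : Π p : M, TangentSpace I p} (hZ : IsSmoothField Z) (v : TangentSpace I p) :
      covAlong I cov φ (fun q ↦ mvfderiv I f q (Z q) • ξ q + f q • covAlong I cov φ ξ q (Z q)) p v
        = mvfderiv I (fun q ↦ mvfderiv I f q (Z q)) p v • ξ p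
          + mvfderiv I f p (Z p) • covAlong I cov φ ξ p v
          + (mvfderiv I f p v • covAlong I cov φ ξ p (Z p)
            + f p • covAlong I cov φ (fun q ↦ covAlong I cov φ ξ q (Z q)) p v) := by
    rw [covAlong_add cov (hξ.smul (contMDiff_mvfderiv hf hZ))
      ((isSmoothAlong_covAlong hcov hξ hZ).smul hf),
      covAlong_smul cov (contMDiff_mvfderiv hf hZ) hξ,
      covAlong_smul cov hf (isSmoothAlong_covAlong hcov hξ hZ)]
  simp only [curvatureAlong]
  simp only [covAlong_smul cov hf hξ]
  rw [hexp hX, hexp hY, mvfderiv_mlieBracket hf hX hY]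
  module

/-- The curvature of the pulled back connection is the pull back of the curvature tensor. -/
theorem curvatureAlong_eq (hcov : CovariantDerivative.ContMDiffCovariantDerivative cov ∞)
    (htor : cov.torsion = 0) (hξ : IsSmoothAlong I I' φ ξ) (hX : IsSmoothField X)
    (hY : IsSmoothField Y) {U V W : Π x : N, TangentSpace I' x} (hU : IsSmoothField U)
    (hV : IsSmoothField V) (hW : IsSmoothField W)
    (hUX : U (φ p) = mfderiv I I' φ p (X p)) (hVY : V (φ p) = mfderiv I I' φ p (Y p))
    (hWξ : W (φ p) = ξ p) :
    curvatureAlong cov φ X Y ξ p = affineCurvature cov U V W (φ p) := by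
  obtain ⟨L, hL⟩ := exists_linearMap_of_tensorial hξ.base p
    (Φ := fun ξ ↦ curvatureAlong cov φ X Y ξ p)
    (fun ξ η _ _ h ↦ curvatureAlong_congr h)
    (fun ξ η hξ hη ↦ curvatureAlong_add hcov hX hY hξ hη)
    (fun f ξ hf hξ ↦ curvatureAlong_smul hcov hX hY hf hξ)
  rw [← curvatureAlong_comp hcov htor hξ.base hX hY hU hV hW hUX hVY, hL ξ hξ,
    hL _ (hW.isSmoothAlong hξ.base), hWξ]

end Curvature

/-! ### Algebra of Kähler curvature forms -/

section AlgebraicCurvature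

/-- The symmetries of the curvature tensor `(a, b, c, d) ↦ g(R(a, b) c, d)` of a Kähler manifold at
a point. -/
structure IsKaehlerCurvatureForm {V : Type*} [AddCommGroup V] (J : V → V)
    (Q : V → V → V → V → ℝ) : Prop where
  add_first : ∀ a a' b c d, Q (a + a') b c d = Q a b c d + Q a' b c d
  add_third : ∀ a b c c' d, Q a b (c + c') d = Q a b c d + Q a b c' d
  skew : ∀ a b c d, Q a b c d = -Q b a c d
  skew' : ∀ a b c d, Q a b c d = -Q a b d c
  bianchi : ∀ a b c d, Q a b c d + Q b c a d + Q c a b d = 0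
  complex : ∀ a b c d, Q a b (J c) (J d) = Q a b c d

namespace IsKaehlerCurvatureForm

variable {V : Type*} {J : V → V} {Q : V → V → V → V → ℝ}

section Symmetry

variable [AddCommGroup V]

/-- The octahedron argument: a signed sum of four Bianchi identities, simplified by the two skew
symmetries. -/
lemma pair_symm (h : IsKaehlerCurvatureForm J Q) (a b c d : V) : Q a b c d = Q c d a b := by
  have h1 := h.bianchi a b c d
  have h2 := h.bianchi b c d a
  have h3 := h.bianchi c d a b
  have h4 := h.bianchi d a b c
  have s := h.skew
  have s' := h.skew'
  linarith [s' b c a d, s' c a b d, s' a b c d, s c a b d, s c d b a, s' c d b a, s d b c a,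
    s' d b c a, s' b d c a, s d a c b, s' a d c b, s a c d b, s' a c d b, s b d a c, s' b d a c,
    s a b d c, s d a b c, s' d a b c, s' a b d c, s' d a c b, s a c b d, s' a c b d]

lemma add_second (h : IsKaehlerCurvatureForm J Q) (a b b' c d : V) :
    Q a (b + b') c d = Q a b c d + Q a b' c d := by
  rw [h.skew, h.add_first, h.skew b, h.skew b']
  ring

lemma add_fourth (h : IsKaehlerCurvatureForm J Q) (a b c d d' : V) :
    Q a b c (d + d') = Q a b c d + Q a b c d' := by
  rw [h.skew', h.add_third, h.skew' a b d, h.skew' a b d']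
  ring

lemma neg_first (h : IsKaehlerCurvatureForm J Q) (a b c d : V) : Q (-a) b c d = -Q a b c d := by
  have h1 := h.add_first a (-a) b c d
  have h2 := h.add_first 0 0 b c d
  rw [add_neg_cancel] at h1
  rw [add_zero] at h2
  linarith

lemma neg_third (h : IsKaehlerCurvatureForm J Q) (a b c d : V) : Q a b (-c) d = -Q a b c d := by
  rw [h.pair_symm, h.neg_first, h.pair_symm]

lemma neg_second (h : IsKaehlerCurvatureForm J Q) (a b c d : V) : Q a (-b) c d = -Q a b c d := by
  rw [h.skew, h.neg_first, h.skew b, neg_neg]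

lemma neg_fourth (h : IsKaehlerCurvatureForm J Q) (a b c d : V) : Q a b c (-d) = -Q a b c d := by
  rw [h.skew', h.neg_third, h.skew' a b d, neg_neg]

lemma complex' (h : IsKaehlerCurvatureForm J Q) (a b c d : V) : Q (J a) (J b) c d = Q a b c d := by
  rw [h.pair_symm, h.complex, h.pair_symm]

end Symmetry

variable [NormedAddCommGroup V] [InnerProductSpace ℝ V]

/-- Adding `hμ` at x + y and x - y kills the terms odd in y. Six terms quadratic in both remain;
with K and L the two curvatures in the statement, four of them equal L and two equal K + L, so 2K +
6L = 2μ|x|²|y|². -/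
lemma polarization (h : IsKaehlerCurvatureForm J Q) (hJ : ∀ v, J (J v) = -v)
    (hadd : ∀ v w, J (v + w) = J v + J w) {μ : ℝ}
    (hμ : ∀ v, Q v (J v) (J v) v = μ * ⟪v, v⟫ ^ 2) {x y : V} (hxy : ⟪x, y⟫ = 0) :
    Q x y y x + 3 * Q x (J y) (J y) x = μ * (⟪x, x⟫ * ⟪y, y⟫) := by
  have hneg (v : V) : J (-v) = -J v := by rw [← hJ v, hJ (J v)]
  have hyx : ⟪y, x⟫ = 0 := by rw [real_inner_comm, hxy]
  have hp := hμ (x + y)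
  have hm := hμ (x + -y)
  have hx := hμ x
  have hy := hμ y
  simp only [hadd, hneg, h.add_first, h.add_second, h.add_third, h.add_fourth, h.neg_first,
    h.neg_second, h.neg_third, h.neg_fourth, inner_add_left, inner_add_right, inner_neg_left,
    inner_neg_right, hxy, hyx] at hp hm
  have e1 : Q x (J y) (J x) y = Q x (J y) (J y) x := by
    rw [← h.complex x (J y) (J x) y, hJ, h.neg_third, h.skew' x (J y) x, neg_neg]
  have e2 : Q y (J x) (J y) x = Q x (J y) (J y) x := by
    rw [← h.complex' y (J x) (J y) x, hJ, h.neg_second, ← h.skew]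
  have e3 : Q y (J x) (J x) y = Q x (J y) (J y) x := by
    rw [← h.complex' y (J x) (J x) y, hJ, h.neg_second, ← h.skew, e1]
  have e4 : Q x (J x) (J y) y = Q x y y x + Q x (J y) (J y) x := by
    have := h.bianchi x (J x) (J y) y
    rw [h.complex', h.skew (J y) x, e1, h.skew' x y x y] at this
    linarith
  have e5 : Q y (J y) (J x) x = Q x y y x + Q x (J y) (J y) x := by
    rw [h.pair_symm, h.skew, h.skew', neg_neg, e4]
  rw [e1, e2, e3, e4, e5, hx, hy] at hp hm
  linarith

/-- The sectional curvature of a totally real plane. -/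
theorem apply_of_orthogonal (h : IsKaehlerCurvatureForm J Q) (hJ : ∀ v, J (J v) = -v)
    (hadd : ∀ v w, J (v + w) = J v + J w) (horth : ∀ v w, ⟪J v, J w⟫ = ⟪v, w⟫) {μ : ℝ}
    (hμ : ∀ v, Q v (J v) (J v) v = μ * ⟪v, v⟫ ^ 2) {x y : V} (hxy : ⟪x, y⟫ = 0)
    (hxJy : ⟪x, J y⟫ = 0) : Q x y y x = μ / 4 * (⟪x, x⟫ * ⟪y, y⟫) := by
  have h1 := h.polarization hJ hadd hμ hxy
  -- Replacing y by J y exchanges the two unknowns of `h1`, so both equal a quarter of the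
  -- right-hand side.
  have h2 := h.polarization hJ hadd hμ hxJy
  rw [hJ, h.neg_second, h.neg_third, horth] at h2
  linarith

end IsKaehlerCurvatureForm

end AlgebraicCurvature

/-! ### The curvature tensor of the ambient Kähler manifold -/

section AmbientCurvature

variable {E : Type*} [NormedAddCommGroup E] [NormedSpace ℝ E] [FiniteDimensional ℝ E]
  {H : Type*} [TopologicalSpace H] {I : ModelWithCorners ℝ E H}
  {N : Type*} [TopologicalSpace N] [ChartedSpace H N] [IsManifold I ∞ N] [T2Space N]
  {cov : CovariantDerivative I E (fun x : N ↦ TangentSpace I x)}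
  {U V W U' V' W' : Π x : N, TangentSpace I x} {x : N}

lemma IsSmoothField.add (hU : IsSmoothField U) (hV : IsSmoothField V) :
    IsSmoothField (fun x ↦ U x + V x) :=
  IsSmoothAlong.add (φ := (id : N → N)) (I := I) hU hV

lemma IsSmoothField.apply {J : Π x : N, TangentSpace I x →L[ℝ] TangentSpace I x}
    (hJ : ContMDiff I (I.prod 𝓘(ℝ, E →L[ℝ] E)) ∞
      (fun x ↦ (⟨x, J x⟩ : TotalSpace (E →L[ℝ] E)
        (fun x : N ↦ TangentSpace I x →L[ℝ] TangentSpace I x))))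
    (hU : IsSmoothField U) : IsSmoothField (fun x ↦ J x (U x)) :=
  isSmoothAlong_apply (φ := (id : N → N)) (I := I) hJ hU

/-- Pulling back by the identity, `curvatureAlong_eq` already allows the ambient fields to be
replaced by any with the same values. -/
lemma affineCurvature_congr (hcov : CovariantDerivative.ContMDiffCovariantDerivative cov ∞)
    (htor : cov.torsion = 0) (hU : IsSmoothField U) (hV : IsSmoothField V) (hW : IsSmoothField W)
    (hU' : IsSmoothField U') (hV' : IsSmoothField V') (hW' : IsSmoothField W')
    (hUU' : U x = U' x) (hVV' : V x = V' x) (hWW' : W x = W' x) :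
    affineCurvature cov U V W x = affineCurvature cov U' V' W' x := by
  have hid (v : TangentSpace I x) : mfderiv I I (id : N → N) x v = v := by rw [mfderiv_id]; rfl
  have h1 := curvatureAlong_eq (φ := (id : N → N)) (p := x) hcov htor
    hW.isSmoothAlong_id hU hV hU hV hW (hid _).symm (hid _).symm rfl
  have h2 := curvatureAlong_eq (φ := (id : N → N)) (p := x) hcov htor
    hW.isSmoothAlong_id hU hV hU' hV' hW' (hUU'.symm.trans (hid _).symm)
    (hVV'.symm.trans (hid _).symm) hWW'.symm
  exact h1.symm.trans h2

lemma isSmoothField_mlieBracket (hcov : CovariantDerivative.ContMDiffCovariantDerivative cov ∞)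
    (htor : cov.torsion = 0) (hU : IsSmoothField U) (hV : IsSmoothField V) :
    IsSmoothField (mlieBracket I U V) := by
  have h : mlieBracket I U V = fun x ↦ cov V x (U x) - cov U x (V x) := by
    ext x
    exact (CovariantDerivative.torsion_eq_zero_iff cov |>.1 htor
      (hU.mdifferentiableAt x) (hV.mdifferentiableAt x)).symm
  rw [h]
  exact IsSmoothAlong.sub (φ := (id : N → N)) (I := I)
    (isSmoothField_cov hcov hV hU) (isSmoothField_cov hcov hU hV)

lemma cov_add (hU : IsSmoothField U) (hV : IsSmoothField V) (v : TangentSpace I x) :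
    cov (fun y ↦ U y + V y) x v = cov U x v + cov V x v := by
  have h := cov.isCovariantDerivativeOnUniv.add (hU.mdifferentiableAt x) (hV.mdifferentiableAt x)
  exact DFunLike.congr_fun h v

lemma cov_sub (hU : IsSmoothField U) (hV : IsSmoothField V) (v : TangentSpace I x) :
    cov (fun y ↦ U y - V y) x v = cov U x v - cov V x v := by
  have hUV : IsSmoothField (fun y ↦ U y - V y) :=
    IsSmoothAlong.sub (φ := (id : N → N)) (I := I) hU hV
  have h := cov_add (cov := cov) hUV hV v
  simp only [sub_add_cancel] at h
  rw [eq_sub_iff_add_eq]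
  exact h.symm

lemma affineCurvature_add_left (hcov : CovariantDerivative.ContMDiffCovariantDerivative cov ∞)
    (hU : IsSmoothField U) (hU' : IsSmoothField U') (hW : IsSmoothField W) :
    affineCurvature cov (fun x ↦ U x + U' x) V W x
      = affineCurvature cov U V W x + affineCurvature cov U' V W x := by
  have h : mlieBracket I (fun x ↦ U x + U' x) V x = mlieBracket I U V x + mlieBracket I U' V x :=
    mlieBracket_add_left (hU.mdifferentiableAt x) (hU'.mdifferentiableAt x)
  simp only [affineCurvature, map_add, h]
  rw [cov_add (isSmoothField_cov hcov hW hU) (isSmoothField_cov hcov hW hU')]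
  module

lemma affineCurvature_add_right (hcov : CovariantDerivative.ContMDiffCovariantDerivative cov ∞)
    (hU : IsSmoothField U) (hV : IsSmoothField V) (hW : IsSmoothField W) (hW' : IsSmoothField W') :
    affineCurvature cov U V (fun x ↦ W x + W' x) x
      = affineCurvature cov U V W x + affineCurvature cov U V W' x := by
  simp only [affineCurvature]
  simp only [cov_add hW hW']
  rw [cov_add (isSmoothField_cov hcov hW hV) (isSmoothField_cov hcov hW' hV),
    cov_add (isSmoothField_cov hcov hW hU) (isSmoothField_cov hcov hW' hU)]
  module

lemma affineCurvature_swap : affineCurvature cov U V W x = -affineCurvature cov V U W x := by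
  simp only [affineCurvature]
  rw [mlieBracket_swap_apply (V := U), map_neg]
  module

/-- The first Bianchi identity. -/
lemma affineCurvature_bianchi (hcov : CovariantDerivative.ContMDiffCovariantDerivative cov ∞)
    (htor : cov.torsion = 0) (hU : IsSmoothField U) (hV : IsSmoothField V) (hW : IsSmoothField W) :
    affineCurvature cov U V W x + affineCurvature cov V W U x + affineCurvature cov W U V x
      = 0 := by
  have tor {A B : Π x : N, TangentSpace I x} (hA : IsSmoothField A) (hB : IsSmoothField B) (y : N) :
      mlieBracket I A B y = cov B y (A y) - cov A y (B y) :=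
    (CovariantDerivative.torsion_eq_zero_iff cov |>.1 htor
      (hA.mdifferentiableAt y) (hB.mdifferentiableAt y)).symm
  -- Vanishing torsion turns [A, [B, C]] into ∇_A ∇_B C - ∇_A ∇_C B - ∇_{[B, C]} A, so the cyclic
  -- Jacobi sum regroups into the cyclic sum of curvatures.
  have key {A B C : Π x : N, TangentSpace I x} (hA : IsSmoothField A) (hB : IsSmoothField B)
      (hC : IsSmoothField C) : mlieBracket I A (mlieBracket I B C) x
        = cov (fun y ↦ cov C y (B y)) x (A x) - cov (fun y ↦ cov B y (C y)) x (A x)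
          - cov A x (mlieBracket I B C x) := by
    rw [tor hA (isSmoothField_mlieBracket hcov htor hB hC)]
    congr 1
    rw [← cov_sub (isSmoothField_cov hcov hC hB) (isSmoothField_cov hcov hB hC)]
    congr 2
    ext y
    exact tor hB hC y
  have jac : mlieBracket I U (mlieBracket I V W) x + mlieBracket I V (mlieBracket I W U) x
      + mlieBracket I W (mlieBracket I U V) x = 0 := by
    have h2 : minSmoothness ℝ 2 ≤ (∞ : WithTop ℕ∞) := by
      rw [minSmoothness_of_isRCLikeNormedField]
      exact ENat.LEInfty.out
    have : IsManifold I (minSmoothness ℝ 3) N := by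
      rw [minSmoothness_of_isRCLikeNormedField]
      exact IsManifold.of_le (n := ∞) ENat.LEInfty.out
    have hneg : mlieBracket I V (mlieBracket I U W) x = -mlieBracket I V (mlieBracket I W U) x := by
      rw [mlieBracket_swap (V := U), ← neg_one_smul ℝ (mlieBracket I W U),
        mlieBracket_const_smul_right
          ((isSmoothField_mlieBracket hcov htor hW hU).mdifferentiableAt x), neg_one_smul]
    rw [leibniz_identity_mlieBracket_apply ((hU x).of_le h2) ((hV x).of_le h2) ((hW x).of_le h2),
      hneg, mlieBracket_swap_apply (V := W)]
    module
  rw [key hU hV hW, key hV hW hU, key hW hU hV] at jac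
  rw [← jac]
  simp only [affineCurvature]
  module

section Metric

variable [RiemannianBundle (fun x : N ↦ TangentSpace I x)]
  [IsContMDiffRiemannianBundle I ∞ E (fun x : N ↦ TangentSpace I x)]

lemma mvfderiv_inner (hcov : IsLeviCivita cov) (hU : IsSmoothField U) (hV : IsSmoothField V)
    (v : TangentSpace I x) :
    mvfderiv I (fun y ↦ ⟪U y, V y⟫) x v = ⟪cov U x v, V x⟫ + ⟪U x, cov V x v⟫ :=
  hcov.metric U V x (hU.mdifferentiableAt x) (hV.mdifferentiableAt x) v

/-- Apply [U, V] as a commutator to the function ⟨W, W'⟩ and expand by metricity; the products of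
first derivatives cancel. -/
lemma inner_affineCurvature_skew (hcov : IsLeviCivita cov) (hU : IsSmoothField U)
    (hV : IsSmoothField V) (hW : IsSmoothField W) (hW' : IsSmoothField W') :
    ⟪affineCurvature cov U V W x, W' x⟫ = -⟪affineCurvature cov U V W' x, W x⟫ := by
  have hs {A B : Π x : N, TangentSpace I x} (hA : IsSmoothField A) (hB : IsSmoothField B) :
      ContMDiff I 𝓘(ℝ, ℝ) ∞ (fun y ↦ ⟪A y, B y⟫) :=
    IsSmoothAlong.inner (φ := (id : N → N)) (I := I) hA hB
  have h2 {A B : Π x : N, TangentSpace I x} (hA : IsSmoothField A) (hB : IsSmoothField B) :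
      mvfderiv I (fun y ↦ mvfderiv I (fun y ↦ ⟪W y, W' y⟫) y (B y)) x (A x)
        = ⟪cov (fun y ↦ cov W y (B y)) x (A x), W' x⟫ + ⟪cov W x (B x), cov W' x (A x)⟫
          + (⟪cov W x (A x), cov W' x (B x)⟫ + ⟪W x, cov (fun y ↦ cov W' y (B y)) x (A x)⟫) := by
    have hc {C : Π x : N, TangentSpace I x} (hC : IsSmoothField C) :=
      isSmoothField_cov hcov.smooth hC hB
    simp only [mvfderiv_inner hcov hW hW']
    rw [mvfderiv_fun_add ((hs (hc hW) hW' x).mdifferentiableAt (by simp))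
      ((hs hW (hc hW') x).mdifferentiableAt (by simp)), add_apply, mvfderiv_inner hcov (hc hW) hW',
      mvfderiv_inner hcov hW (hc hW')]
  have h := mvfderiv_mlieBracket (hs hW hW') hU hV x
  rw [h2 hU hV, h2 hV hU, mvfderiv_inner hcov hW hW'] at h
  simp only [affineCurvature, inner_sub_left]
  simp only [real_inner_comm _ (W x)] at h ⊢
  linarith

lemma affineCurvature_complex (hcov : CovariantDerivative.ContMDiffCovariantDerivative cov ∞)
    {J : Π x : N, TangentSpace I x →L[ℝ] TangentSpace I x}
    (hJ : IsKaehlerStructure cov J) (hU : IsSmoothField U) (hV : IsSmoothField V)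
    (hW : IsSmoothField W) :
    affineCurvature cov U V (fun x ↦ J x (W x)) x = J x (affineCurvature cov U V W x) := by
  simp only [affineCurvature, hJ.parallel W hW, map_sub]
  rw [hJ.parallel _ (isSmoothField_cov hcov hW hV), hJ.parallel _ (isSmoothField_cov hcov hW hU)]

end Metric

section Tensor

variable (cov) in
/-- The curvature tensor of the connection `cov`. -/
noncomputable def curvatureTensor (x : N) (u v w : TangentSpace I x) : TangentSpace I x :=
  affineCurvature cov (exists_isSmoothField_eq x u).choose (exists_isSmoothField_eq x v).choose
    (exists_isSmoothField_eq x w).choose x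

lemma curvatureTensor_eq (hcov : CovariantDerivative.ContMDiffCovariantDerivative cov ∞)
    (htor : cov.torsion = 0) (hU : IsSmoothField U) (hV : IsSmoothField V) (hW : IsSmoothField W)
    (x : N) : curvatureTensor cov x (U x) (V x) (W x) = affineCurvature cov U V W x := by
  have hu := (exists_isSmoothField_eq x (U x)).choose_spec
  have hv := (exists_isSmoothField_eq x (V x)).choose_spec
  have hw := (exists_isSmoothField_eq x (W x)).choose_spec
  exact affineCurvature_congr hcov htor hu.1 hv.1 hw.1 hU hV hW hu.2 hv.2 hw.2

variable [RiemannianBundle (fun x : N ↦ TangentSpace I x)]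
  [IsContMDiffRiemannianBundle I ∞ E (fun x : N ↦ TangentSpace I x)]

/-- The symmetries of the curvature tensor of a Kähler manifold. -/
theorem isKaehlerCurvatureForm (hcov : IsLeviCivita cov)
    {J : Π x : N, TangentSpace I x →L[ℝ] TangentSpace I x}
    (hJ : IsKaehlerStructure cov J) (x : N) :
    IsKaehlerCurvatureForm (fun v ↦ J x v) (fun a b c d ↦ ⟪curvatureTensor cov x a b c, d⟫) := by
  have hs := hcov.smooth
  have ht := hcov.torsion_free
  constructor
  · intro a a' b c d
    obtain ⟨A, hA, rfl⟩ := exists_isSmoothField_eq x a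
    obtain ⟨A', hA', rfl⟩ := exists_isSmoothField_eq x a'
    obtain ⟨B, hB, rfl⟩ := exists_isSmoothField_eq x b
    obtain ⟨C, hC, rfl⟩ := exists_isSmoothField_eq x c
    rw [← inner_add_left, curvatureTensor_eq hs ht hA hB hC, curvatureTensor_eq hs ht hA' hB hC,
      ← affineCurvature_add_left hs hA hA' hC, ← curvatureTensor_eq hs ht (hA.add hA') hB hC]
  · intro a b c c' d
    obtain ⟨A, hA, rfl⟩ := exists_isSmoothField_eq x a
    obtain ⟨B, hB, rfl⟩ := exists_isSmoothField_eq x b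
    obtain ⟨C, hC, rfl⟩ := exists_isSmoothField_eq x c
    obtain ⟨C', hC', rfl⟩ := exists_isSmoothField_eq x c'
    rw [← inner_add_left, curvatureTensor_eq hs ht hA hB hC, curvatureTensor_eq hs ht hA hB hC',
      ← affineCurvature_add_right hs hA hB hC hC', ← curvatureTensor_eq hs ht hA hB (hC.add hC')]
  · intro a b c d
    obtain ⟨A, hA, rfl⟩ := exists_isSmoothField_eq x a
    obtain ⟨B, hB, rfl⟩ := exists_isSmoothField_eq x b
    obtain ⟨C, hC, rfl⟩ := exists_isSmoothField_eq x c
    rw [curvatureTensor_eq hs ht hA hB hC, curvatureTensor_eq hs ht hB hA hC, affineCurvature_swap,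
      inner_neg_left]
  · intro a b c d
    obtain ⟨A, hA, rfl⟩ := exists_isSmoothField_eq x a
    obtain ⟨B, hB, rfl⟩ := exists_isSmoothField_eq x b
    obtain ⟨C, hC, rfl⟩ := exists_isSmoothField_eq x c
    obtain ⟨D, hD, rfl⟩ := exists_isSmoothField_eq x d
    rw [curvatureTensor_eq hs ht hA hB hC, curvatureTensor_eq hs ht hA hB hD,
      inner_affineCurvature_skew hcov hA hB hC hD]
  · intro a b c d
    obtain ⟨A, hA, rfl⟩ := exists_isSmoothField_eq x a
    obtain ⟨B, hB, rfl⟩ := exists_isSmoothField_eq x b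
    obtain ⟨C, hC, rfl⟩ := exists_isSmoothField_eq x c
    rw [← inner_add_left, ← inner_add_left, curvatureTensor_eq hs ht hA hB hC,
      curvatureTensor_eq hs ht hB hC hA, curvatureTensor_eq hs ht hC hA hB,
      affineCurvature_bianchi hs ht hA hB hC, inner_zero_left]
  · intro a b c d
    obtain ⟨A, hA, rfl⟩ := exists_isSmoothField_eq x a
    obtain ⟨B, hB, rfl⟩ := exists_isSmoothField_eq x b
    obtain ⟨C, hC, rfl⟩ := exists_isSmoothField_eq x c
    rw [curvatureTensor_eq hs ht hA hB (hC.apply hJ.smooth), curvatureTensor_eq hs ht hA hB hC,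
      affineCurvature_complex hs hJ hA hB hC, hJ.orthogonal]

/-- The sectional curvature of a totally real plane in a complex space form is `μ / 4`. -/
theorem inner_curvatureTensor_of_orthogonal
    {J : Π x : N, TangentSpace I x →L[ℝ] TangentSpace I x} {μ : ℝ}
    (hN : IsComplexSpaceForm cov J μ) {v w : TangentSpace I x} (hvw : ⟪v, w⟫ = 0)
    (hvJw : ⟪v, J x w⟫ = 0) :
    ⟪curvatureTensor cov x v w w, v⟫ = μ / 4 * (⟪v, v⟫ * ⟪w, w⟫) := by
  refine (isKaehlerCurvatureForm hN.leviCivita hN.kaehler x).apply_of_orthogonal (hN.kaehler.sq x)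
    (fun v w ↦ map_add _ v w) (hN.kaehler.orthogonal x) (fun v ↦ ?_) hvw hvJw
  obtain ⟨V, hV, rfl⟩ := exists_isSmoothField_eq x v
  have hJV := hV.apply hN.kaehler.smooth
  rw [curvatureTensor_eq hN.leviCivita.smooth hN.leviCivita.torsion_free hV hJV hJV,
    hN.holomorphicCurvature V hV]

end Tensor

end AmbientCurvature

/-! ### Smooth local orthonormal frames -/

section OrthonormalFrame

variable {E : Type*} [NormedAddCommGroup E] [NormedSpace ℝ E] [FiniteDimensional ℝ E]
  {H : Type*} [TopologicalSpace H] {I : ModelWithCorners ℝ E H}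
  {M : Type*} [TopologicalSpace M] [ChartedSpace H M] [IsManifold I ∞ M] [T2Space M]
  [RiemannianBundle (fun x : M ↦ TangentSpace I x)]
  [IsContMDiffRiemannianBundle I ∞ E (fun x : M ↦ TangentSpace I x)] {p : M}

lemma IsSmoothField.inner {X Y : Π q : M, TangentSpace I q} (hX : IsSmoothField X)
    (hY : IsSmoothField Y) : ContMDiff I 𝓘(ℝ, ℝ) ∞ (fun q ↦ ⟪X q, Y q⟫) :=
  IsSmoothAlong.inner (φ := (id : M → M)) (I := I) hX hY

/-- An orthonormal family at `p` extends to smooth vector fields which are orthonormal around `p`: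
this is the Gram-Schmidt process. -/
lemma exists_eventually_orthonormal {ι : Type*} [DecidableEq ι] {b : ι → TangentSpace I p}
    (hb : Orthonormal ℝ b) (s : Finset ι) :
    ∃ e : ι → Π q : M, TangentSpace I q, (∀ i, IsSmoothField (e i)) ∧ (∀ i, e i p = b i) ∧
      ∀ᶠ q in 𝓝 p, ∀ i ∈ s, ∀ j ∈ s, ⟪e i q, e j q⟫ = if i = j then 1 else 0 := by
  induction s using Finset.induction_on with
  | empty =>
    choose e he he' using fun i ↦ exists_isSmoothField_eq p (b i)
    exact ⟨e, he, he', by simp⟩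
  | insert a s ha ih =>
    obtain ⟨e, he, hep, horth⟩ := ih
    have hZ : IsSmoothField (fun q ↦ e a q - ∑ i ∈ s, ⟪e i q, e a q⟫ • e i q) :=
      IsSmoothAlong.sub (φ := (id : M → M)) (I := I) (he a)
        (IsSmoothAlong.sum (φ := (id : M → M)) (I := I) s contMDiff_id fun i _ ↦
          IsSmoothAlong.smul (φ := (id : M → M)) ((he i).inner (he a)) (he i))
    set Z : Π q : M, TangentSpace I q := fun q ↦ e a q - ∑ i ∈ s, ⟪e i q, e a q⟫ • e i q with hZ_def
    -- The family is already orthonormal at p, so the Gram-Schmidt step does not change the value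
    -- there.
    have hZp : Z p = b a := by
      simp only [hZ_def, hep]
      rw [Finset.sum_eq_zero fun i hi ↦ ?_, sub_zero]
      rw [hb.2 (by rintro rfl; exact ha hi), zero_smul]
    have hpos : ∀ᶠ q in 𝓝 p, 0 < ⟪Z q, Z q⟫ := by
      refine (hZ.inner hZ).continuous.continuousAt.eventually (lt_mem_nhds ?_)
      change 0 < ⟪Z p, Z p⟫
      rw [hZp, real_inner_self_eq_norm_sq, hb.1 a]
      norm_num
    -- The normalizing factor 1/|Z| is known to be smooth only near p, where Z ≠ 0; g is a global
    -- function equal to it near p.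
    obtain ⟨g, hg, hge⟩ := exists_contMDiff_eventuallyEq (I := I) (p := p) (F := ℝ)
      (f := fun q ↦ (Real.sqrt ⟪Z q, Z q⟫)⁻¹) (by
        filter_upwards [hpos] with q hq
        have h : ContDiffAt ℝ ∞ (fun t : ℝ ↦ (Real.sqrt t)⁻¹) ⟪Z q, Z q⟫ :=
          (Real.contDiffAt_sqrt hq.ne').inv (Real.sqrt_pos.2 hq).ne'
        exact ContMDiffAt.comp (g := fun t : ℝ ↦ (Real.sqrt t)⁻¹) q h.contMDiffAt (hZ.inner hZ q))
    refine ⟨Function.update e a fun q ↦ g q • Z q, fun i ↦ ?_, fun i ↦ ?_, ?_⟩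
    · by_cases hi : i = a
      · subst hi
        rw [Function.update_self]
        exact IsSmoothAlong.smul (φ := (id : M → M)) hg hZ
      · rw [Function.update_of_ne hi]
        exact he i
    · by_cases hi : i = a
      · subst hi
        rw [Function.update_self, hge.self_of_nhds, hZp, real_inner_self_eq_norm_sq, hb.1 i]
        simp
      · rw [Function.update_of_ne hi, hep]
    · filter_upwards [horth, hpos, hge] with q hq hqpos hqg
      have hiZ : ∀ i ∈ s, ⟪e i q, Z q⟫ = 0 := by
        intro i hi
        simp only [hZ_def, inner_sub_right, inner_sum, real_inner_smul_right]
        rw [Finset.sum_congr rfl fun j hj ↦ by rw [hq i hi j hj]]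
        simp [hi]
      have hgg : g q * (g q * ⟪Z q, Z q⟫) = 1 := by
        rw [hqg]
        have := Real.mul_self_sqrt hqpos.le
        have h0 := (Real.sqrt_pos.2 hqpos).ne'
        field_simp
        linarith
      have hne : ∀ i ∈ s, i ≠ a := fun i hi h ↦ ha (h ▸ hi)
      intro i hi j hj
      rcases Finset.mem_insert.1 hi with rfl | hi' <;> rcases Finset.mem_insert.1 hj with hj' | hj'
      · subst hj'
        simp only [Function.update_self, real_inner_smul_left, real_inner_smul_right, if_true]
        exact hgg
      · rw [Function.update_self, Function.update_of_ne (hne j hj'), if_neg (hne j hj').symm,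
          real_inner_smul_left, real_inner_comm, hiZ j hj', mul_zero]
      · subst hj'
        rw [Function.update_self, Function.update_of_ne (hne i hi'), if_neg (hne i hi'),
          real_inner_smul_right, hiZ i hi', mul_zero]
      · rw [Function.update_of_ne (hne i hi'), Function.update_of_ne (hne j hj'), hq i hi' j hj']

variable (I) in
/-- There is a smooth orthonormal frame around every point. -/
theorem exists_orthonormalFrame (p : M) :
    ∃ e : Fin (finrank ℝ E) → Π q : M, TangentSpace I q, (∀ i, IsSmoothField (e i)) ∧
      ∀ᶠ q in 𝓝 p, ∃ b : OrthonormalBasis (Fin (finrank ℝ E)) ℝ (TangentSpace I q),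
        ∀ i, b i = e i q := by
  let b₀ : OrthonormalBasis (Fin (finrank ℝ E)) ℝ (TangentSpace I p) :=
    stdOrthonormalBasis ℝ (TangentSpace I p)
  obtain ⟨e, he, -, h⟩ := exists_eventually_orthonormal b₀.orthonormal Finset.univ
  refine ⟨e, he, ?_⟩
  filter_upwards [h] with q hq
  have horth : Orthonormal ℝ (fun i ↦ e i q) :=
    orthonormal_iff_ite.2 fun i j ↦ hq i (Finset.mem_univ i) j (Finset.mem_univ j)
  have hcard : Fintype.card (Fin (finrank ℝ E)) = finrank ℝ (TangentSpace I q) :=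
    Fintype.card_fin _
  refine ⟨OrthonormalBasis.mk horth ?_, fun i ↦ by rw [OrthonormalBasis.coe_mk]⟩
  exact (horth.linearIndependent.span_eq_top_of_card_eq_finrank' hcard).ge

end OrthonormalFrame

/-! ### Tangential and normal components -/

section Projections

variable {E : Type*} [NormedAddCommGroup E] [NormedSpace ℝ E] [FiniteDimensional ℝ E]
  {H : Type*} [TopologicalSpace H] {I : ModelWithCorners ℝ E H}
  {M : Type*} [TopologicalSpace M] [ChartedSpace H M] [IsManifold I ∞ M]
  {E' : Type*} [NormedAddCommGroup E'] [NormedSpace ℝ E'] [FiniteDimensional ℝ E']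
  {H' : Type*} [TopologicalSpace H'] {I' : ModelWithCorners ℝ E' H'}
  {N : Type*} [TopologicalSpace N] [ChartedSpace H' N] [IsManifold I' ∞ N]
  [RiemannianBundle (fun x : M ↦ TangentSpace I x)]
  [RiemannianBundle (fun x : N ↦ TangentSpace I' x)]
  {φ : M → N} {ξ : Π p : M, TangentSpace I' (φ p)} {p : M}

variable (I) in
lemma inner_tangentialPart (w : TangentSpace I' (φ p)) (v : TangentSpace I p) :
    ⟪tangentialPart I I' φ p w, v⟫ = ⟪w, mfderiv I I' φ p v⟫ :=
  LinearMap.adjoint_inner_left _ v w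

lemma tangentialPart_mfderiv (hφ : IsIsometricImmersion I I' φ) (v : TangentSpace I p) :
    tangentialPart I I' φ p (mfderiv I I' φ p v) = v :=
  ext_inner_right ℝ fun w ↦ by rw [inner_tangentialPart, hφ.isometric]

lemma tangentialPart_eq_zero {w : TangentSpace I' (φ p)}
    (hw : ∀ v : TangentSpace I p, ⟪w, mfderiv I I' φ p v⟫ = 0) :
    tangentialPart I I' φ p w = 0 :=
  ext_inner_right ℝ fun v ↦ by rw [inner_tangentialPart, hw, inner_zero_left]

variable (I) in
lemma normalPart_add (v w : TangentSpace I' (φ p)) :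
    normalPart I I' φ p (v + w) = normalPart I I' φ p v + normalPart I I' φ p w := by
  simp only [normalPart, map_add]
  module

variable (I) in
lemma normalPart_smul (c : ℝ) (v : TangentSpace I' (φ p)) :
    normalPart I I' φ p (c • v) = c • normalPart I I' φ p v := by
  simp only [normalPart, map_smul]
  module

variable (I) in
lemma normalPart_sub (v w : TangentSpace I' (φ p)) :
    normalPart I I' φ p (v - w) = normalPart I I' φ p v - normalPart I I' φ p w := by
  simp only [normalPart, map_sub]
  module

lemma normalPart_mfderiv (hφ : IsIsometricImmersion I I' φ) (v : TangentSpace I p) :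
    normalPart I I' φ p (mfderiv I I' φ p v) = 0 := by
  rw [normalPart, tangentialPart_mfderiv hφ, sub_self]

lemma normalPart_eq_self {w : TangentSpace I' (φ p)}
    (hw : ∀ v : TangentSpace I p, ⟪w, mfderiv I I' φ p v⟫ = 0) :
    normalPart I I' φ p w = w := by
  rw [normalPart, tangentialPart_eq_zero hw, map_zero, sub_zero]

lemma inner_normalPart_mfderiv (hφ : IsIsometricImmersion I I' φ) (w : TangentSpace I' (φ p))
    (v : TangentSpace I p) : ⟪normalPart I I' φ p w, mfderiv I I' φ p v⟫ = 0 := by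
  rw [normalPart, inner_sub_left, hφ.isometric, inner_tangentialPart, sub_self]

lemma inner_normalPart {η : TangentSpace I' (φ p)}
    (hη : ∀ v : TangentSpace I p, ⟪η, mfderiv I I' φ p v⟫ = 0) (w : TangentSpace I' (φ p)) :
    ⟪normalPart I I' φ p w, η⟫ = ⟪w, η⟫ := by
  rw [normalPart, inner_sub_left, real_inner_comm _ (mfderiv I I' φ p _), hη, sub_zero]

variable [T2Space M] [T2Space N] [IsContMDiffRiemannianBundle I ∞ E (fun x : M ↦ TangentSpace I x)]
  [IsContMDiffRiemannianBundle I' ∞ E' (fun x : N ↦ TangentSpace I' x)]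

/-- The adjoint is defined pointwise; in a smooth local orthonormal frame it is ∑ ⟨dφ e_i, ξ⟩ e_i.
-/
lemma isSmoothField_tangentialPart (hξ : IsSmoothAlong I I' φ ξ) :
    IsSmoothField (fun q ↦ tangentialPart I I' φ q (ξ q)) := by
  refine isSmoothAlong_of_eventuallyEq (φ := (id : M → M)) fun p ↦ ?_
  obtain ⟨e, he, h⟩ := exists_orthonormalFrame I p
  refine ⟨fun q ↦ ∑ i, ⟪mfderiv I I' φ q (e i q), ξ q⟫ • e i q,
    IsSmoothAlong.sum (φ := (id : M → M)) (I := I) _ contMDiff_id fun i _ ↦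
      IsSmoothAlong.smul (φ := (id : M → M))
        ((IsSmoothAlong.mfderiv hξ.base (he i)).inner hξ) (he i), ?_⟩
  filter_upwards [h] with q hq
  obtain ⟨b, hb⟩ := hq
  change tangentialPart I I' φ q (ξ q) = _
  rw [← b.sum_repr' (tangentialPart I I' φ q (ξ q))]
  refine Finset.sum_congr rfl fun i _ ↦ ?_
  rw [hb, real_inner_comm, inner_tangentialPart, real_inner_comm]

lemma isSmoothAlong_normalPart (hξ : IsSmoothAlong I I' φ ξ) :
    IsSmoothAlong I I' φ (fun q ↦ normalPart I I' φ q (ξ q)) :=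
  hξ.sub (IsSmoothAlong.mfderiv hξ.base (isSmoothField_tangentialPart hξ))

lemma isNormalField_normalPart (hφ : IsIsometricImmersion I I' φ) (hξ : IsSmoothAlong I I' φ ξ) :
    IsNormalField I I' φ (fun q ↦ normalPart I I' φ q (ξ q)) :=
  ⟨isSmoothAlong_normalPart hξ, fun _ v ↦ inner_normalPart_mfderiv hφ _ v⟩

/-- Lets hypotheses about normal fields be used for a single normal vector: extend it arbitrarily
and project. -/
lemma exists_isNormalField_eq (hφ : IsIsometricImmersion I I' φ)
    {w : TangentSpace I' (φ p)} (hw : ∀ v : TangentSpace I p, ⟪w, mfderiv I I' φ p v⟫ = 0) :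
    ∃ ξ, IsNormalField I I' φ ξ ∧ ξ p = w := by
  obtain ⟨W, hW, hWw⟩ := exists_isSmoothField_eq (φ p) w
  refine ⟨_, isNormalField_normalPart hφ (hW.isSmoothAlong hφ.smooth), ?_⟩
  rw [hWw, normalPart_eq_self hw]

end Projections

/-! ### The Gauss, Weingarten and Ricci equations -/

section GaussWeingarten

variable {E : Type*} [NormedAddCommGroup E] [NormedSpace ℝ E] [FiniteDimensional ℝ E]
  {H : Type*} [TopologicalSpace H] {I : ModelWithCorners ℝ E H}
  {M : Type*} [TopologicalSpace M] [ChartedSpace H M] [IsManifold I ∞ M] [T2Space M]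
  {E' : Type*} [NormedAddCommGroup E'] [NormedSpace ℝ E'] [FiniteDimensional ℝ E']
  {H' : Type*} [TopologicalSpace H'] {I' : ModelWithCorners ℝ E' H'}
  {N : Type*} [TopologicalSpace N] [ChartedSpace H' N] [IsManifold I' ∞ N] [T2Space N]
  [RiemannianBundle (fun x : M ↦ TangentSpace I x)]
  [RiemannianBundle (fun x : N ↦ TangentSpace I' x)]
  {φ : M → N} {ξ η : Π p : M, TangentSpace I' (φ p)} {X Y : Π p : M, TangentSpace I p} {p : M}
  {cov : CovariantDerivative I' E' (fun x : N ↦ TangentSpace I' x)}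

variable (cov) in
-- The Leibniz term (v f) dφ W is tangent, so the normal projection removes it and the expression is
-- tensorial in W. The extension used to define σ can thus be replaced by any smooth field.
lemma exists_secondFundamentalForm_linear (hφ : IsIsometricImmersion I I' φ)
    (v : TangentSpace I p) :
    ∃ L : TangentSpace I p →ₗ[ℝ] TangentSpace I' (φ p),
      (∀ W : Π q : M, TangentSpace I q, IsSmoothField W →
        normalPart I I' φ p (covAlong I cov φ (fun q ↦ mfderiv I I' φ q (W q)) p v) = L (W p)) ∧
      ∀ w, secondFundamentalForm cov φ p v w = L w := by
  obtain ⟨L, hL⟩ := exists_linearMap_of_tensorial (I := I) (φ := (id : M → M)) contMDiff_id p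
    (Φ := fun W ↦ normalPart I I' φ p (covAlong I cov φ (fun q ↦ mfderiv I I' φ q (W q)) p v))
    (by
      intro W W' _ _ h
      congr 1
      refine covAlong_congr cov ?_ v
      filter_upwards [h] with q hq
      rw [hq])
    (by
      intro W W' hW hW'
      rw [← normalPart_add, ← covAlong_add cov (IsSmoothAlong.mfderiv hφ.smooth hW)
        (IsSmoothAlong.mfderiv hφ.smooth hW')]
      congr 2
      ext q
      exact map_add _ _ _)
    (by
      intro f W hf hW
      have h := covAlong_smul cov (p := p) hf (IsSmoothAlong.mfderiv hφ.smooth hW) v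
      have h' : (fun q ↦ mfderiv I I' φ q (f q • W q))
          = fun q ↦ f q • mfderiv I I' φ q (W q) := by
        ext q
        exact map_smul _ _ _
      change normalPart I I' φ p (covAlong I cov φ (fun q ↦ mfderiv I I' φ q (f q • W q)) p v) = _
      rw [h', h, normalPart_add, normalPart_smul, normalPart_smul, normalPart_mfderiv hφ, smul_zero,
        zero_add])
  refine ⟨L, hL, fun w ↦ ?_⟩
  obtain ⟨W, hW, hWe⟩ := exists_isSmoothField_extend I p w
  have hWp : W p = w := by rw [hWe.self_of_nhds, FiberBundle.extend_apply_self]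
  rw [← hWp, ← hL W hW, hWp, secondFundamentalForm]
  congr 1
  refine covAlong_congr cov ?_ v
  filter_upwards [hWe] with q hq
  rw [hq]

/-- The Gauss formula. -/
lemma normalPart_covAlong_mfderiv (hφ : IsIsometricImmersion I I' φ) (hX : IsSmoothField X)
    (v : TangentSpace I p) :
    normalPart I I' φ p (covAlong I cov φ (fun q ↦ mfderiv I I' φ q (X q)) p v)
      = secondFundamentalForm cov φ p v (X p) := by
  obtain ⟨L, hL, hL'⟩ := exists_secondFundamentalForm_linear cov hφ v
  rw [hL X hX, hL']

lemma secondFundamentalForm_add_right (hφ : IsIsometricImmersion I I' φ)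
    (u v w : TangentSpace I p) :
    secondFundamentalForm cov φ p u (v + w)
      = secondFundamentalForm cov φ p u v + secondFundamentalForm cov φ p u w := by
  obtain ⟨L, -, hL⟩ := exists_secondFundamentalForm_linear cov hφ u
  rw [hL, hL, hL, map_add]

lemma secondFundamentalForm_smul_right (hφ : IsIsometricImmersion I I' φ)
    (c : ℝ) (u v : TangentSpace I p) :
    secondFundamentalForm cov φ p u (c • v) = c • secondFundamentalForm cov φ p u v := by
  obtain ⟨L, -, hL⟩ := exists_secondFundamentalForm_linear cov hφ u
  rw [hL, hL, map_smul]

lemma secondFundamentalForm_symm (htor : cov.torsion = 0) (hφ : IsIsometricImmersion I I' φ)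
    (u v : TangentSpace I p) :
    secondFundamentalForm cov φ p u v = secondFundamentalForm cov φ p v u := by
  obtain ⟨X, hX, rfl⟩ := exists_isSmoothField_eq p u
  obtain ⟨Y, hY, rfl⟩ := exists_isSmoothField_eq p v
  rw [← normalPart_covAlong_mfderiv hφ hX, ← normalPart_covAlong_mfderiv hφ hY, ← sub_eq_zero,
    ← normalPart_sub, covAlong_mfderiv_sub htor hφ.smooth hX hY, normalPart_mfderiv hφ]

variable (cov) in
/-- The second fundamental form at `p` as a bilinear map. -/
noncomputable def secondFundamentalFormBilin (htor : cov.torsion = 0)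
    (hφ : IsIsometricImmersion I I' φ) (p : M) :
    TangentSpace I p →ₗ[ℝ] TangentSpace I p →ₗ[ℝ] TangentSpace I' (φ p) :=
  LinearMap.mk₂ ℝ (secondFundamentalForm cov φ p)
    (fun u v w ↦ by
      rw [secondFundamentalForm_symm htor hφ, secondFundamentalForm_add_right hφ,
        secondFundamentalForm_symm htor hφ w, secondFundamentalForm_symm htor hφ w])
    (fun c u v ↦ by
      rw [secondFundamentalForm_symm htor hφ, secondFundamentalForm_smul_right hφ,
        secondFundamentalForm_symm htor hφ v])
    (secondFundamentalForm_add_right hφ) (secondFundamentalForm_smul_right hφ)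

/-- The trace of the second fundamental form can be computed in any orthonormal basis. -/
lemma meanCurvature_eq_sum (htor : cov.torsion = 0) (hφ : IsIsometricImmersion I I' φ)
    {ι : Type*} [Fintype ι] (b : OrthonormalBasis ι ℝ (TangentSpace I p)) :
    meanCurvature I cov φ p
      = (finrank ℝ E : ℝ)⁻¹ • ∑ i, secondFundamentalForm cov φ p (b i) (b i) := by
  have h {κ : Type} [Fintype κ] (c : OrthonormalBasis κ ℝ (TangentSpace I p)) :
      ∑ i, secondFundamentalForm cov φ p (c i) (c i)
        = ∑ i, secondFundamentalForm cov φ p (b i) (b i) := by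
    -- The tensor ∑ b_i ⊗ b_i does not depend on the orthonormal basis, and the trace is its image
    -- under σ.
    have h1 := InnerProductSpace.canonicalCovariantTensor_eq_sum (TangentSpace I p) c
    have h2 := InnerProductSpace.canonicalCovariantTensor_eq_sum (TangentSpace I p) b
    have h3 := congrArg (TensorProduct.lift (secondFundamentalFormBilin cov htor hφ p))
      (h1.symm.trans h2)
    simpa only [map_sum, TensorProduct.lift.tmul, secondFundamentalFormBilin,
      LinearMap.mk₂_apply] using h3
  rw [meanCurvature, h]

variable (cov) in
lemma normalConnection_eq (φ : M → N) (ξ : Π p : M, TangentSpace I' (φ p)) (p : M)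
    (v : TangentSpace I p) :
    normalConnection cov φ ξ p v
      = covAlong I cov φ ξ p v + mfderiv I I' φ p (shapeOperator cov φ ξ p v) := by
  rw [normalConnection, normalPart, shapeOperator, map_neg, sub_eq_add_neg]

variable [IsContMDiffRiemannianBundle I ∞ E (fun x : M ↦ TangentSpace I x)]
  [IsContMDiffRiemannianBundle I' ∞ E' (fun x : N ↦ TangentSpace I' x)]

/-- Differentiate ⟨ξ, dφ W⟩ = 0 in the direction v. -/
lemma inner_secondFundamentalForm (hcov : IsLeviCivita cov) (hφ : IsIsometricImmersion I I' φ)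
    (hξ : IsNormalField I I' φ ξ) (v w : TangentSpace I p) :
    ⟪secondFundamentalForm cov φ p v w, ξ p⟫ = ⟪shapeOperator cov φ ξ p v, w⟫ := by
  obtain ⟨W, hW, rfl⟩ := exists_isSmoothField_eq p w
  have h := mvfderiv_inner_along hcov hξ.smooth (IsSmoothAlong.mfderiv hφ.smooth hW) p v
  simp only [hξ.normal, mvfderiv_const] at h
  rw [← normalPart_covAlong_mfderiv hφ hW, inner_normalPart (hξ.normal p), shapeOperator,
    inner_neg_left, inner_tangentialPart, real_inner_comm]
  change 0 = _ at h
  linarith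

lemma inner_shapeOperator_comm (hcov : IsLeviCivita cov) (hφ : IsIsometricImmersion I I' φ)
    (hξ : IsNormalField I I' φ ξ) (v w : TangentSpace I p) :
    ⟪shapeOperator cov φ ξ p v, w⟫ = ⟪v, shapeOperator cov φ ξ p w⟫ := by
  rw [← inner_secondFundamentalForm hcov hφ hξ, secondFundamentalForm_symm hcov.torsion_free hφ,
    inner_secondFundamentalForm hcov hφ hξ, real_inner_comm]

lemma isSmoothField_shapeOperator (hcov : IsLeviCivita cov) (hξ : IsSmoothAlong I I' φ ξ)
    (hX : IsSmoothField X) : IsSmoothField (fun q ↦ shapeOperator cov φ ξ q (X q)) :=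
  IsSmoothAlong.neg (φ := (id : M → M)) (I := I)
    (isSmoothField_tangentialPart (isSmoothAlong_covAlong hcov.smooth hξ hX))

/-- The orthonormal basis in the definition is chosen point by point, with no regularity;
independence of the basis allows a smooth local frame instead. -/
lemma isNormalField_meanCurvature (hcov : IsLeviCivita cov) (hφ : IsIsometricImmersion I I' φ) :
    IsNormalField I I' φ (meanCurvature I cov φ) := by
  have htor := hcov.torsion_free
  refine ⟨isSmoothAlong_of_eventuallyEq fun p ↦ ?_, fun p v ↦ ?_⟩
  · obtain ⟨e, he, h⟩ := exists_orthonormalFrame I p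
    refine ⟨_, IsSmoothAlong.const_smul (finrank ℝ E : ℝ)⁻¹ (IsSmoothAlong.sum Finset.univ hφ.smooth
      fun i _ ↦ isSmoothAlong_normalPart (isSmoothAlong_covAlong hcov.smooth
        (IsSmoothAlong.mfderiv hφ.smooth (he i)) (he i))), ?_⟩
    filter_upwards [h] with q hq
    obtain ⟨b, hb⟩ := hq
    rw [meanCurvature_eq_sum htor hφ b]
    congr 1
    refine Finset.sum_congr rfl fun i _ ↦ ?_
    rw [hb, normalPart_covAlong_mfderiv hφ (he i)]
  · simp only [meanCurvature, real_inner_smul_left, sum_inner, secondFundamentalForm,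
      inner_normalPart_mfderiv hφ, Finset.sum_const_zero, mul_zero]

/-- Writing D = ∇ + dφ A for the inner derivative, the correction dφ (A_ξ X) contributes the normal
vector σ(v, A_ξ X), which pairs with η through A_η. -/
lemma inner_normalConnection_normalConnection (hcov : IsLeviCivita cov)
    (hφ : IsIsometricImmersion I I' φ) (hξ : IsNormalField I I' φ ξ) (hη : IsNormalField I I' φ η)
    (hX : IsSmoothField X) (v : TangentSpace I p) :
    ⟪normalConnection cov φ (fun q ↦ normalConnection cov φ ξ q (X q)) p v, η p⟫
      = ⟪covAlong I cov φ (fun q ↦ covAlong I cov φ ξ q (X q)) p v, η p⟫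
        + ⟪shapeOperator cov φ η p v, shapeOperator cov φ ξ p (X p)⟫ := by
  have hA := isSmoothField_shapeOperator hcov hξ.smooth hX
  have h : (fun q ↦ normalConnection cov φ ξ q (X q)) = fun q ↦ covAlong I cov φ ξ q (X q)
      + mfderiv I I' φ q (shapeOperator cov φ ξ q (X q)) :=
    funext fun q ↦ normalConnection_eq cov φ ξ q (X q)
  rw [normalConnection, h, covAlong_add cov (isSmoothAlong_covAlong hcov.smooth hξ.smooth hX)
    (IsSmoothAlong.mfderiv hφ.smooth hA), normalPart_add, inner_add_left,
    normalPart_covAlong_mfderiv hφ hA, inner_secondFundamentalForm hcov hφ hη,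
    inner_normalPart (hη.normal p)]

/-- The Ricci equation. -/
theorem inner_normalCurvature (hcov : IsLeviCivita cov) (hφ : IsIsometricImmersion I I' φ)
    (hξ : IsNormalField I I' φ ξ) (hη : IsNormalField I I' φ η)
    (hX : IsSmoothField X) (hY : IsSmoothField Y) (p : M) :
    ⟪normalCurvature cov φ X Y ξ p, η p⟫
      = ⟪curvatureTensor cov (φ p) (mfderiv I I' φ p (X p)) (mfderiv I I' φ p (Y p)) (ξ p), η p⟫
        + (⟪shapeOperator cov φ η p (X p), shapeOperator cov φ ξ p (Y p)⟫
          - ⟪shapeOperator cov φ η p (Y p), shapeOperator cov φ ξ p (X p)⟫) := by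
  obtain ⟨U, hU, hU'⟩ := exists_isSmoothField_eq (φ p) (mfderiv I I' φ p (X p))
  obtain ⟨V, hV, hV'⟩ := exists_isSmoothField_eq (φ p) (mfderiv I I' φ p (Y p))
  obtain ⟨W, hW, hW'⟩ := exists_isSmoothField_eq (φ p) (ξ p)
  have hR := curvatureAlong_eq hcov.smooth hcov.torsion_free hξ.smooth hX hY hU hV hW hU' hV' hW'
  rw [← curvatureTensor_eq hcov.smooth hcov.torsion_free hU hV hW, hU', hV', hW'] at hR
  rw [← hR, normalCurvature, inner_sub_left, inner_sub_left,
    inner_normalConnection_normalConnection hcov hφ hξ hη hY,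
    inner_normalConnection_normalConnection hcov hφ hξ hη hX, normalConnection,
    inner_normalPart (hη.normal p), curvatureAlong, inner_sub_left, inner_sub_left]
  ring

/-- The Ricci equation for commuting shape operators. -/
theorem inner_normalCurvature_of_commute (hcov : IsLeviCivita cov)
    (hφ : IsIsometricImmersion I I' φ) (hcomm : HasCommutativeSecondFundamentalForms I cov φ)
    (hξ : IsNormalField I I' φ ξ) (hη : IsNormalField I I' φ η)
    (hX : IsSmoothField X) (hY : IsSmoothField Y) (p : M) :
    ⟪normalCurvature cov φ X Y ξ p, η p⟫
      = ⟪curvatureTensor cov (φ p) (mfderiv I I' φ p (X p)) (mfderiv I I' φ p (Y p)) (ξ p),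
        η p⟫ := by
  rw [inner_normalCurvature hcov hφ hξ hη hX hY, inner_shapeOperator_comm hcov hφ hη (X p),
    ← hcomm ξ η hξ hη, ← inner_shapeOperator_comm hcov hφ hξ,
    real_inner_comm (shapeOperator cov φ η p (Y p)), sub_self, add_zero]

end GaussWeingarten

/-! ### Totally real submanifolds and the conclusion -/

section TotallyReal

variable {E : Type*} [NormedAddCommGroup E] [NormedSpace ℝ E] [FiniteDimensional ℝ E]
  {H : Type*} [TopologicalSpace H] {I : ModelWithCorners ℝ E H}
  {M : Type*} [TopologicalSpace M] [ChartedSpace H M] [IsManifold I ∞ M] [T2Space M]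
  {E' : Type*} [NormedAddCommGroup E'] [NormedSpace ℝ E'] [FiniteDimensional ℝ E']
  {H' : Type*} [TopologicalSpace H'] {I' : ModelWithCorners ℝ E' H'}
  {N : Type*} [TopologicalSpace N] [ChartedSpace H' N] [IsManifold I' ∞ N] [T2Space N]
  [RiemannianBundle (fun x : M ↦ TangentSpace I x)]
  [RiemannianBundle (fun x : N ↦ TangentSpace I' x)]
  {φ : M → N} {ξ η : Π p : M, TangentSpace I' (φ p)} {p : M}
  {cov : CovariantDerivative I' E' (fun x : N ↦ TangentSpace I' x)}
  [IsContMDiffRiemannianBundle I ∞ E (fun x : M ↦ TangentSpace I x)]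
  [IsContMDiffRiemannianBundle I' ∞ E' (fun x : N ↦ TangentSpace I' x)]
  {J : Π x : N, TangentSpace I' x →L[ℝ] TangentSpace I' x}

/-- For a totally real submanifold with parallel `f`-structure, `σ(v, w) = J A_{Jw} v`. -/
theorem secondFundamentalForm_eq_of_parallel (hJ : IsKaehlerStructure cov J)
    (hφ : IsIsometricImmersion I I' φ) (hreal : IsTotallyReal I φ J)
    (hf : HasParallelNormalFStructure I cov φ J) (hξ : IsNormalField I I' φ ξ)
    {w : TangentSpace I p} (hξw : ξ p = J (φ p) (mfderiv I I' φ p w)) (v : TangentSpace I p) :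
    secondFundamentalForm cov φ p v w
      = J (φ p) (mfderiv I I' φ p (shapeOperator cov φ ξ p v)) := by
  have hJξ := isSmoothAlong_apply hJ.smooth hξ.smooth
  have hT := isSmoothField_tangentialPart hJξ
  have hTp : tangentialPart I I' φ p (J (φ p) (ξ p)) = -w := by
    rw [hξw, hJ.sq, map_neg, tangentialPart_mfderiv hφ]
  -- Let T be the tangential part of Jξ, so T(p) = -w. From fξ = Jξ - dφ T the left side is (J∇_v
  -- ξ)^⊥ + σ(v, w). On the right, D_v ξ = ∇_v ξ + dφ A_ξ v and J dφ A_ξ v is already normal, which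
  -- gives (J∇_v ξ)^⊥ + J dφ A_ξ v.
  have h := hf ξ hξ p v
  rw [normalConnection_eq cov φ ξ, normalF, map_add, normalPart_add,
    normalPart_eq_self (hreal p (shapeOperator cov φ ξ p v))] at h
  simp only [normalConnection, normalF] at h
  have h2 : covAlong I cov φ (fun q ↦ normalPart I I' φ q (J (φ q) (ξ q))) p v
      = J (φ p) (covAlong I cov φ ξ p v) - covAlong I cov φ (fun q ↦ mfderiv I I' φ q
        (tangentialPart I I' φ q (J (φ q) (ξ q)))) p v := by
    rw [← covAlong_kaehler hJ hξ.smooth,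
      ← covAlong_sub cov hJξ (IsSmoothAlong.mfderiv hφ.smooth hT)]
    rfl
  rw [h2, normalPart_sub, normalPart_covAlong_mfderiv hφ hT, hTp, ← neg_one_smul ℝ w,
    secondFundamentalForm_smul_right hφ, sub_eq_add_neg, neg_one_smul, neg_neg] at h
  exact add_left_cancel h

/-- The shape operators `A_{Jw}` at a point of a totally real submanifold with commutative second
fundamental forms and parallel `f`-structure. -/
theorem exists_shapeOperator (hcov : IsLeviCivita cov)
    (hJ : IsKaehlerStructure cov J) (hφ : IsIsometricImmersion I I' φ)
    (hreal : IsTotallyReal I φ J) (hcomm : HasCommutativeSecondFundamentalForms I cov φ)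
    (hf : HasParallelNormalFStructure I cov φ J) (p : M) :
    ∃ A : TangentSpace I p → TangentSpace I p → TangentSpace I p,
      (∀ v w, secondFundamentalForm cov φ p v w = J (φ p) (mfderiv I I' φ p (A w v))) ∧
      (∀ v w, A v w = A w v) ∧ (∀ u v w, ⟪A u v, w⟫ = ⟪v, A u w⟫) ∧
      ∀ u v w, A u (A v w) = A v (A u w) := by
  choose ξ hξ hξp using fun w : TangentSpace I p ↦ exists_isNormalField_eq hφ (hreal p w)
  have hσ (v w : TangentSpace I p) := secondFundamentalForm_eq_of_parallel hJ hφ hreal hf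
    (hξ w) (hξp w) v
  refine ⟨fun w v ↦ shapeOperator cov φ (ξ w) p v, hσ, fun v w ↦ ?_,
    fun u v w ↦ inner_shapeOperator_comm hcov hφ (hξ u) v w,
    fun u v w ↦ hcomm _ _ (hξ u) (hξ v) p w⟩
  -- J ∘ dφ preserves inner products, so the symmetry of σ passes to A.
  have h := hσ v w
  rw [secondFundamentalForm_symm hcov.torsion_free hφ, hσ w v] at h
  refine ext_inner_right ℝ fun u ↦ ?_
  rw [← hφ.isometric, ← hφ.isometric, ← hJ.orthogonal, h, hJ.orthogonal]

/-- Commuting symmetric operators `A u`, with `A u v` symmetric in `u` and `v` and of trace zero,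
vanish. -/
lemma eq_zero_of_sum_eq_zero {V : Type*} [NormedAddCommGroup V] [InnerProductSpace ℝ V]
    {A : V → V → V} (hsymm : ∀ v w, A v w = A w v) (hself : ∀ u v w, ⟪A u v, w⟫ = ⟪v, A u w⟫)
    (hcomm : ∀ u v w, A u (A v w) = A v (A u w)) {ι : Type*} [Fintype ι]
    (b : OrthonormalBasis ι ℝ V) (h : ∑ i, A (b i) (b i) = 0) (u v : V) : A u v = 0 := by
  have h1 : ∑ i, ⟪A u (b i), A u (b i)⟫ = 0 := by
    -- A_u A_u b_i = A_u A_{b_i} u = A_{b_i} A_u u, by symmetry and then commutation.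
    have h2 (i : ι) : ⟪A u (b i), A u (b i)⟫ = ⟪A (b i) (b i), A u u⟫ := by
      rw [hself, hsymm u (b i), hcomm, ← hself]
    simp only [h2]
    rw [← sum_inner, h, inner_zero_left]
  have h3 (i : ι) : A u (b i) = 0 :=
    inner_self_eq_zero.1 ((Finset.sum_eq_zero_iff_of_nonneg
      fun i _ ↦ real_inner_self_nonneg).1 h1 i (Finset.mem_univ i))
  rw [← b.sum_repr' (A u v)]
  exact Finset.sum_eq_zero fun i _ ↦ by rw [← hself, h3, inner_zero_left, zero_smul]

/-- The mean curvature vector vanishes if it is semiparallel and `μ ≠ 0`. -/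
theorem meanCurvature_eq_zero {μ : ℝ} (hN : IsComplexSpaceForm cov J μ) (hμ : μ ≠ 0)
    (hdim : 1 < finrank ℝ E) (hφ : IsIsometricImmersion I I' φ)
    (hreal : IsTotallyReal I φ J) (hcomm : HasCommutativeSecondFundamentalForms I cov φ)
    (hf : HasParallelNormalFStructure I cov φ J) (hH : HasSemiparallelMeanCurvature I cov φ)
    (p : M) : meanCurvature I cov φ p = 0 := by
  have hcov := hN.leviCivita
  have hJ := hN.kaehler
  obtain ⟨A, hA, -⟩ := exists_shapeOperator hcov hJ hφ hreal hcomm hf p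
  obtain ⟨h, hh⟩ : ∃ h : TangentSpace I p,
      meanCurvature I cov φ p = J (φ p) (mfderiv I I' φ p h) := by
    refine ⟨(finrank ℝ E : ℝ)⁻¹ • ∑ i, A (stdOrthonormalBasis ℝ (TangentSpace I p) i)
      (stdOrthonormalBasis ℝ (TangentSpace I p) i), ?_⟩
    simp only [meanCurvature, hA, map_smul, map_sum]
  -- This is where n > 1 enters: the line spanned by h cannot fill the tangent space.
  obtain ⟨x, hxh, hx⟩ : ∃ x : TangentSpace I p, ⟪x, h⟫ = 0 ∧ x ≠ 0 := by
    by_contra! hall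
    have h1 : (Submodule.span ℝ {h})ᗮ = ⊥ := by
      refine (Submodule.eq_bot_iff _).2 fun x hx ↦ hall x ?_
      rw [real_inner_comm]
      exact Submodule.mem_orthogonal_singleton_iff_inner_right.1 hx
    have h2 := Submodule.finrank_add_finrank_orthogonal (Submodule.span ℝ {h})
    rw [h1, finrank_bot, add_zero] at h2
    have h3 := finrank_span_le_card (R := ℝ) ({h} : Set (TangentSpace I p))
    rw [Set.toFinset_singleton, Finset.card_singleton] at h3
    have h4 : finrank ℝ (TangentSpace I p) = finrank ℝ E := rfl
    omega
  obtain ⟨X, hX, rfl⟩ := exists_isSmoothField_eq p x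
  obtain ⟨Y, hY, rfl⟩ := exists_isSmoothField_eq p h
  -- With η = J dφ X and H = J dφ Y at p, the two J's cancel in the curvature form, leaving the
  -- curvature of the plane of X and Y.
  obtain ⟨η, hη, hηp⟩ := exists_isNormalField_eq hφ (hreal p (X p))
  have hR := inner_normalCurvature_of_commute hcov hφ hcomm (isNormalField_meanCurvature hcov hφ)
    hη hX hY p
  rw [hH X Y hX hY, inner_zero_left, hηp, hh,
    (isKaehlerCurvatureForm hcov hJ (φ p)).complex] at hR
  rw [inner_curvatureTensor_of_orthogonal hN ((hφ.isometric p _ _).trans hxh)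
    (by rw [real_inner_comm, hreal]), hφ.isometric, hφ.isometric] at hR
  have hY0 : Y p = 0 := by
    rcases mul_eq_zero.1 hR.symm with h0 | h0
    · exact absurd h0 (by positivity)
    · rcases mul_eq_zero.1 h0 with h0 | h0
      · exact absurd (inner_self_eq_zero.1 h0) hx
      · exact inner_self_eq_zero.1 h0
  rw [hh, hY0, map_zero, map_zero]

end TotallyReal

theorem proposition3 {m n : ℕ} (hn : 1 < n)
    {N : Type*} [TopologicalSpace N] [T2Space N]
    [ChartedSpace (EuclideanSpace ℝ (Fin (2 * m))) N] [IsManifold (𝓡 (2 * m)) ∞ N]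
    [RiemannianBundle (fun x : N ↦ TangentSpace (𝓡 (2 * m)) x)]
    [IsContMDiffRiemannianBundle (𝓡 (2 * m)) ∞ (EuclideanSpace ℝ (Fin (2 * m)))
      (fun x : N ↦ TangentSpace (𝓡 (2 * m)) x)]
    {M : Type*} [TopologicalSpace M] [T2Space M]
    [ChartedSpace (EuclideanSpace ℝ (Fin n)) M] [IsManifold (𝓡 n) ∞ M]
    [RiemannianBundle (fun x : M ↦ TangentSpace (𝓡 n) x)]
    [IsContMDiffRiemannianBundle (𝓡 n) ∞ (EuclideanSpace ℝ (Fin n))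
      (fun x : M ↦ TangentSpace (𝓡 n) x)]
    (cov : CovariantDerivative (𝓡 (2 * m)) (EuclideanSpace ℝ (Fin (2 * m)))
      (fun x : N ↦ TangentSpace (𝓡 (2 * m)) x))
    (J : Π x : N, TangentSpace (𝓡 (2 * m)) x →L[ℝ] TangentSpace (𝓡 (2 * m)) x)
    (μ : ℝ) (hN : IsComplexSpaceForm cov J μ)
    (φ : M → N) (hφ : IsIsometricImmersion (𝓡 n) (𝓡 (2 * m)) φ)
    (hreal : IsTotallyReal (𝓡 n) φ J)
    (hcomm : HasCommutativeSecondFundamentalForms (𝓡 n) cov φ)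
    (hf : HasParallelNormalFStructure (𝓡 n) cov φ J)
    (hH : HasSemiparallelMeanCurvature (𝓡 n) cov φ) :
    IsTotallyGeodesic (𝓡 n) cov φ ∨ μ = 0 := by
  by_cases hμ : μ = 0
  · exact Or.inr hμ
  refine Or.inl fun p v w ↦ ?_
  have hdim : 1 < finrank ℝ (EuclideanSpace ℝ (Fin n)) := by rwa [finrank_euclideanSpace_fin]
  have hmean := meanCurvature_eq_zero hN hμ hdim hφ hreal hcomm hf hH p
  obtain ⟨A, hA, hsymm, hself, hAcomm⟩ :=
    exists_shapeOperator hN.leviCivita hN.kaehler hφ hreal hcomm hf p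
  have hsum : ∑ i, A (stdOrthonormalBasis ℝ (TangentSpace (𝓡 n) p) i)
      (stdOrthonormalBasis ℝ (TangentSpace (𝓡 n) p) i) = 0 := by
    have h0 : (finrank ℝ (EuclideanSpace ℝ (Fin n)) : ℝ)⁻¹ ≠ 0 := by positivity
    rw [meanCurvature, smul_eq_zero_iff_right h0] at hmean
    simp only [hA, ← map_sum] at hmean
    -- J ∘ dφ preserves norms, so the vanishing of tr σ = J dφ (∑ A_{b_i} b_i) gives that of the
    -- sum.
    refine (inner_self_eq_zero (𝕜 := ℝ)).1 ?_
    rw [← hφ.isometric, ← hN.kaehler.orthogonal, hmean, inner_zero_left]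
  rw [hA, eq_zero_of_sum_eq_zero hsymm hself hAcomm _ hsum, map_zero, map_zero]
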